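/- **Definitions.** Let $X$ be a real or complex Banach space and $A:D(A)\subset X\to X$ a closed linear operator. For a subspace $Y\subset X$, the part $A_Y$ of $A$ in $Y$ is the operator on $Y$ with domain $\{y\in D(A)\cap Y: Ay\in Y\}$ and $A_Yy=Ay$. A *trichotomic splitting* of $A$ consists of bounded projectors $\Pi_s,\Pi_c,\Pi_u\in\mathcal L(X)$ with ranges $X_k=\Pi_k(X)$ such that * $X=X_s\oplus X_c\oplus X_u$, $(I-\Pi_s)(X)=X_c\oplus X_u$, $(I-\Pi_c)(X)=X_s\oplus X_u$, $(I-\Pi_u)(X)=X_s\oplus X_c$; * $D(A)=X_s\oplus X_c\oplus(D(A)\cap X_u)$ and $A(D(A)\cap X_k)\subset X_k$ for $k=s,c,u$; * the part $A_s$ of $A$ in $X_s$ belongs to $\mathcal L(X_s)$, the part $A_c$ of $A$ in $X_c$ belongs to $\mathcal L(X_c)$ and is invertible there, and the part $A_u$ of $A$ in $X_u$ is a bijection $D(A_u)\to X_u$ with $A_u^{-1}\in\mathcal L(X_u)$. Let $0<\rho_0<\rho$ and $\kappa\ge 1$. We say that $A$ has an *exponential trichotomy* with exponents $\rho_0<\rho$,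 constant $\kappa$ and projectors $\Pi_k$ if moreover $$\|A_c^n\Pi_c\|_{\mathcal L(X)}\le\kappa e^{\rho_0|n|}\ (n\in\mathbb Z),\qquad \|A_s^n\Pi_s\|_{\mathcal L(X)}\le\kappa e^{-\rho n},\quad \|A_u^{-n}\Pi_u\|_{\mathcal L(X)}\le\kappa e^{-\rho n}\ (n\in\mathbb N).$$ We say that it has an exponential trichotomy with these data *in the subspace norms* if instead $\|A_c^n\|_{\mathcal L(X_c)}\le\kappa e^{\rho_0|n|}$ for $n\in\mathbb Z$ and $\|A_s^n\|_{\mathcal L(X_s)}\le\kappa e^{-\rho n}$, $\|A_u^{-n}\|_{\mathcal L(X_u)}\le\kappa e^{-\rho n}$ for $n\in\mathbb N$. **Theorem (Perturbation).** Let $0<\rho_0<\widehat\rho_0<\widehat\rho<\rho$ and $1\le\kappa<\widehat\kappa$. 1. There is $\delta_0\in(0,\sqrt2-1)$, depending only on $\rho_0,\widehat\rho_0,\widehat\rho,\rho,\kappa,\widehat\kappa$, such that the following holds. Let $A:D(A)\subset X\to X$ be a closed linear operator on a Banach space $X$ having an exponential trichotomy with exponents $\rho_0<\rho$, constant $\kappa$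 and projectors $\Pi_s,\Pi_c,\Pi_u$. Let $0<\delta<\dfrac{\delta_0^2}{\kappa+\delta_0}$ and let $B\in\mathcal L(X)$ satisfy $\|B\|_{\mathcal L(X)}\le\delta$. Then the closed operator $A+B:D(A)\subset X\to X$ has an exponential trichotomy with exponents $\widehat\rho_0<\widehat\rho$, constant $\widehat\kappa$ and some projectors $\widehat\Pi_s,\widehat\Pi_c,\widehat\Pi_u$ such that $$\|\widehat\Pi_k-\Pi_k\|_{\mathcal L(X)}<\frac{\kappa\delta}{\delta_0-\delta}\le\delta_0<\sqrt2-1\qquad(k=s,c,u),$$ the subspaces $\widehat\Pi_k(X)$ and $\Pi_k(X)$ are isomorphic (linearly homeomorphic) for $k=s,c,u$, and $$\|(A+B)_s^n\widehat\Pi_s-A_s^n\Pi_s\|_{\mathcal L(X)}\le\frac{\kappa\delta}{\delta_0-\delta}e^{-\widehat\rho n},\qquad \|(A+B)_u^{-n}\widehat\Pi_u-A_u^{-n}\Pi_u\|_{\mathcal L(X)}\le\frac{\kappa\delta}{\delta_0-\delta}e^{-\widehat\rho n}\qquad(n\in\mathbb N),$$ $$\|(A+B)_c^n\widehat\Pi_c-A_c^n\Pi_c\|_{\mathcal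 L(X)}\le\frac{\kappa\delta}{\delta_0-\delta}e^{\widehat\rho_0|n|}\qquad(n\in\mathbb Z).$$ 2. The same holds with "exponential trichotomy" understood in the subspace norms, both for $A$ (constant $\kappa$) and for $A+B$ (constant $\widehat\kappa$), provided that $\delta_0$ is allowed to depend in addition on a number $M$ with $\|\Pi_k\|_{\mathcal L(X)}\le M$ for $k=s,c,u$. -/

import Mathlib

universe u v

/-- The labels of the three components of a trichotomy: stable, central, unstable. -/
inductive TriLabel : Type
  | s : TriLabel
  | c : TriLabel
  | u : TriLabel

/-- The part `A_Y` of a linear operator `A : D(A) ⊆ X → X` in a subspace `Y`: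
`D(A_Y) = {y ∈ D(A) ∩ Y : A y ∈ Y}` and `A_Y y = A y`. -/
def partIn {𝕜 X : Type*} [Ring 𝕜] [AddCommGroup X] [Module 𝕜 X]
    (A : X →ₗ.[𝕜] X) (Y : Submodule 𝕜 X) : Y →ₗ.[𝕜] Y where
  domain :=
    { carrier := {y | ∃ h : (y : X) ∈ A.domain, A ⟨(y : X), h⟩ ∈ Y}
      add_mem' := by
        rintro a b ⟨ha, ha'⟩ ⟨hb, hb'⟩
        refine ⟨A.domain.add_mem ha hb, ?_⟩
        have h := A.map_add ⟨(a : X), ha⟩ ⟨(b : X), hb⟩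
        have h2 := Y.add_mem ha' hb'
        rw [← h] at h2
        exact h2
      zero_mem' := by
        refine ⟨A.domain.zero_mem, ?_⟩
        have h2 := Y.zero_mem
        rw [← A.map_zero] at h2
        exact h2
      smul_mem' := by
        rintro r a ⟨ha, ha'⟩
        refine ⟨A.domain.smul_mem r ha, ?_⟩
        have h := A.map_smul r ⟨(a : X), ha⟩
        have h2 := Y.smul_mem r ha'
        rw [← h] at h2
        exact h2 }
  toFun :=
    { toFun := fun y => ⟨A ⟨((y : Y) : X), y.2.choose⟩, y.2.choose_spec⟩
      map_add' := by
        intro a b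
        apply Subtype.ext
        exact A.map_add ⟨((a : Y) : X), a.2.choose⟩ ⟨((b : Y) : X), b.2.choose⟩
      map_smul' := by
        intro r a
        apply Subtype.ext
        exact A.map_smul r ⟨((a : Y) : X), a.2.choose⟩ }

/-- A trichotomic splitting of the operator `A : D(A) ⊆ X → X`: `A` is closed and there are three
bounded projectors `Π_s, Π_c, Π_u` with ranges `X_s, X_c, X_u` reducing `A`, such that the part
`A_s` of `A` in `X_s` is a bounded operator on `X_s`, the part `A_c` of `A` in `X_c` is a bounded
invertible operator on `X_c`, and `0` is in the resolvent set of the part `A_u` of `A` in `X_u`.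
The fields `stable`, `central`, `unstableInv` are `A_s`, `A_c`, `A_u⁻¹`; they are determined by
`A` and the projectors. -/
structure TrichotomicSplitting {𝕜 X : Type*} [RCLike 𝕜] [NormedAddCommGroup X] [NormedSpace 𝕜 X]
    (A : X →ₗ.[𝕜] X) where
  /-- `A` is a closed operator. -/
  isClosed : A.IsClosed
  /-- The projectors `Π_k`. -/
  proj : TriLabel → X →L[𝕜] X
  proj_idem : ∀ k, proj k ∘L proj k = proj k
  /-- `X = X_s ⊕ X_c ⊕ X_u`. -/
  independent : iSupIndep fun k => (proj k).range
  spanning : ⨆ k, (proj k).range = ⊤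
  /-- `(I - Π_s)(X) = X_c ⊕ X_u`, `(I - Π_c)(X) = X_s ⊕ X_u`, `(I - Π_u)(X) = X_s ⊕ X_c`. -/
  range_compl : ∀ k, (ContinuousLinearMap.id 𝕜 X - proj k).range = ⨆ j ≠ k, (proj j).range
  /-- `D(A) = X_s ⊕ X_c ⊕ (D(A) ∩ X_u)`; the sum is direct by `independent`. -/
  domain_eq : A.domain =
    (proj .s).range ⊔ (proj .c).range ⊔ (A.domain ⊓ (proj .u).range)
  /-- `A (D(A) ∩ X_k) ⊆ X_k`. -/
  invariant : ∀ k, ∀ x : A.domain, (x : X) ∈ (proj k).range → A x ∈ (proj k).range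
  /-- `A_s ∈ L(X_s)`. -/
  stable : (proj .s).range →L[𝕜] (proj .s).range
  stable_eq : partIn A (proj .s).range = stable.toLinearMap.toPMap ⊤
  /-- `A_c ∈ L(X_c)`, invertible. -/
  central : (proj .c).range ≃L[𝕜] (proj .c).range
  central_eq : partIn A (proj .c).range = central.toLinearEquiv.toLinearMap.toPMap ⊤
  /-- `A_u⁻¹ ∈ L(X_u)`, a two-sided inverse of `A_u : D(A_u) ⊆ X_u → X_u`. -/
  unstableInv : (proj .u).range →L[𝕜] (proj .u).range
  unstableInv_mem : ∀ y, unstableInv y ∈ (partIn A (proj .u).range).domain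
  unstable_right : ∀ y, partIn A (proj .u).range ⟨unstableInv y, unstableInv_mem y⟩ = y
  unstable_left : ∀ x : (partIn A (proj .u).range).domain,
    unstableInv (partIn A (proj .u).range x) = x

namespace TrichotomicSplitting

variable {𝕜 X : Type*} [RCLike 𝕜] [NormedAddCommGroup X] [NormedSpace 𝕜 X]
  {A A' : X →ₗ.[𝕜] X}

/-- The subspace `X_k = Π_k(X)`. -/
abbrev space (T : TrichotomicSplitting A) (k : TriLabel) : Submodule 𝕜 X := (T.proj k).range

/-- The operator `L Π_k ∈ L(X)`, for `L ∈ L(X_k)`. -/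
def extend (T : TrichotomicSplitting A) (k : TriLabel) (L : T.space k →L[𝕜] T.space k) :
    X →L[𝕜] X :=
  (T.space k).subtypeL ∘L L ∘L
    (T.proj k).rangeRestrict

/-- `A_s^n Π_s ∈ L(X)`, `n ≥ 0`. -/
def stableEvol (T : TrichotomicSplitting A) (n : ℕ) : X →L[𝕜] X :=
  T.extend .s (T.stable ^ n)

/-- `A_u^{-n} Π_u ∈ L(X)`, `n ≥ 0`. -/
def unstableEvol (T : TrichotomicSplitting A) (n : ℕ) : X →L[𝕜] X :=
  T.extend .u (T.unstableInv ^ n)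

/-- `A_c^n ∈ L(X_c)`, `n ∈ ℤ`. -/
def centralPow (T : TrichotomicSplitting A) (n : ℤ) : T.space .c →L[𝕜] T.space .c :=
  ((T.central ^ n : T.space .c ≃L[𝕜] T.space .c) : T.space .c →L[𝕜] T.space .c)

/-- `A_c^n Π_c ∈ L(X)`, `n ∈ ℤ`. -/
def centralEvol (T : TrichotomicSplitting A) (n : ℤ) : X →L[𝕜] X :=
  T.extend .c (T.centralPow n)

/-- Trichotomy estimates with exponents `ρ₀ < ρ` and constant `κ`, with the evolutions
`A_k^n` measured in `L(X_k)`. -/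
structure HasSubspaceBounds (T : TrichotomicSplitting A) (ρ₀ ρ κ : ℝ) : Prop where
  exponents : 0 < ρ₀ ∧ ρ₀ < ρ
  one_le : 1 ≤ κ
  central_le : ∀ n : ℤ, ‖T.centralPow n‖ ≤ κ * Real.exp (ρ₀ * |(n : ℝ)|)
  stable_le : ∀ n : ℕ, ‖T.stable ^ n‖ ≤ κ * Real.exp (-ρ * n)
  unstable_le : ∀ n : ℕ, ‖T.unstableInv ^ n‖ ≤ κ * Real.exp (-ρ * n)

/-- Trichotomy estimates with exponents `ρ₀ < ρ` and constant `κ`, with the evolutions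
`A_k^n Π_k` measured in `L(X)`. -/
structure HasBounds (T : TrichotomicSplitting A) (ρ₀ ρ κ : ℝ) : Prop where
  exponents : 0 < ρ₀ ∧ ρ₀ < ρ
  one_le : 1 ≤ κ
  central_le : ∀ n : ℤ, ‖T.centralEvol n‖ ≤ κ * Real.exp (ρ₀ * |(n : ℝ)|)
  stable_le : ∀ n : ℕ, ‖T.stableEvol n‖ ≤ κ * Real.exp (-ρ * n)
  unstable_le : ∀ n : ℕ, ‖T.unstableEvol n‖ ≤ κ * Real.exp (-ρ * n)

/-- The splitting `T'` (of `A'`) is `ε`-close to the splitting `T` (of `A`), with rates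
`ρ₀', ρ'`: the projectors differ by less than `ε`, corresponding subspaces are isomorphic as
topological vector spaces, and the evolutions differ by at most `ε` times the exponential rate. -/
structure IsCloseTo (T' : TrichotomicSplitting A') (T : TrichotomicSplitting A)
    (ρ₀' ρ' ε : ℝ) : Prop where
  proj_lt : ∀ k, ‖T'.proj k - T.proj k‖ < ε
  iso : ∀ k, Nonempty (T'.space k ≃L[𝕜] T.space k)
  stable_le : ∀ n : ℕ, ‖T'.stableEvol n - T.stableEvol n‖ ≤ ε * Real.exp (-ρ' * n)
  unstable_le : ∀ n : ℕ, ‖T'.unstableEvol n - T.unstableEvol n‖ ≤ ε * Real.exp (-ρ' * n)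
  central_le : ∀ n : ℤ,
    ‖T'.centralEvol n - T.centralEvol n‖ ≤ ε * Real.exp (ρ₀' * |(n : ℝ)|)

end TrichotomicSplitting

/-! The perturbed operator is block diagonalised by a similarity close to the identity. Writing
$D(F)$ for the block diagonal part of $F$, one seeks $W = 1 + H$ with $H$ off-diagonal and
$(A+B)(1+H) = (1+H)(A+D)$, where $D = D(B+BH)$. Since $HD$ is again off-diagonal, this is the
Sylvester equation $AH - HA = F - D(F)$ with $F = HD - B - BH$.

The gaps between the rates make this equation solvable by geometric series. Of two different
components, on one the inverse of $A$ is bounded with rate $\alpha$, on the other $A$ is bounded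
with rate $\beta$, and $\alpha\beta < 1$. With $P_n$ the backward powers on the first and $Q_n$ the
forward powers on the second, $\sum P_{n+1} F Q_n$ and $-\sum Q_n F P_{n+1}$ solve the equation in
the two off-diagonal blocks that link them. Six such series give a bounded solution operator
(`exists_sylvester`), and `exists_fixedPoint_quadratic` then yields $H$ of size $O(\|B\|)$.

The blocks of $A + D$ lie within $O(\|B\|)$ of those of $A$. A discrete Duhamel formula compares
their powers, the growth caused by the perturbation being absorbed into the weaker exponents.
Conjugation by $W$ costs another $O(\|B\|)$, so everything is within $C\delta$ of the original
(`exists_isNear`). The threshold $\delta_0$ is then chosen so that $C\delta \le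
\kappa\delta/(\delta_0-\delta)$.

To handle the unbounded $A$, a trichotomy is encoded by four bounded operators on $X$ and three
equations describing the graph of $A$ (`BlockForm`); operator identities become statements about
graphs. -/

/-! ### Trichotomies encoded by bounded operators on the whole space. -/

section Blocks

variable {𝕜 X : Type*} [RCLike 𝕜] [NormedAddCommGroup X] [NormedSpace 𝕜 X]

/-- Passing to graphs hides the chosen membership proof in `partIn` and treats domain and value at
once. -/
theorem mem_graph_partIn {𝕜 X : Type*} [Ring 𝕜] [AddCommGroup X] [Module 𝕜 X]
    (A : X →ₗ.[𝕜] X) (Y : Submodule 𝕜 X) (y z : Y) :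
    (y, z) ∈ (partIn A Y).graph ↔ ((y : X), (z : X)) ∈ A.graph := by
  simp only [LinearPMap.mem_graph_iff]
  constructor
  · rintro ⟨w, rfl, rfl⟩
    exact ⟨⟨_, w.2.choose⟩, rfl, rfl⟩
  · rintro ⟨w, hw, hz⟩
    have hy : (y : X) ∈ A.domain := hw ▸ w.2
    obtain rfl : w = ⟨(y : X), hy⟩ := Subtype.ext hw
    have hd : y ∈ (partIn A Y).domain := ⟨hy, by rw [hz]; exact z.2⟩
    exact ⟨⟨y, hd⟩, rfl, Subtype.ext hz⟩

theorem mem_graph_toPMap_top {𝕜 Y : Type*} [Ring 𝕜] [AddCommGroup Y] [Module 𝕜 Y]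
    (f : Y →ₗ[𝕜] Y) (y z : Y) : (y, z) ∈ (f.toPMap ⊤).graph ↔ f y = z := by
  simp only [LinearPMap.mem_graph_iff]
  constructor
  · rintro ⟨w, rfl, rfl⟩
    rfl
  · intro h
    exact ⟨⟨y, trivial⟩, rfl, h⟩

theorem mem_range_iff_of_idem {p : X →L[𝕜] X} (hp : p * p = p) {x : X} :
    x ∈ p.range ↔ p x = x := by
  constructor
  · rintro ⟨y, rfl⟩
    exact DFunLike.congr_fun hp y
  · intro h
    exact ⟨x, h⟩

/-- Trichotomic block data of an operator `A`, expressed by bounded operators on the whole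
space: `stab`, `cent`, `centInv`, `unstInv` are `A_s Π_s`, `A_c Π_c`, `A_c⁻¹ Π_c`, `A_u⁻¹ Π_u`. -/
structure BlockForm (A : X →ₗ.[𝕜] X) where
  proj : TriLabel → X →L[𝕜] X
  proj_idem : ∀ k, proj k * proj k = proj k
  proj_mul_of_ne : ∀ j k, j ≠ k → proj j * proj k = 0
  sum_proj : proj .s + proj .c + proj .u = 1
  stab : X →L[𝕜] X
  cent : X →L[𝕜] X
  centInv : X →L[𝕜] X
  unstInv : X →L[𝕜] X
  proj_stab : proj .s * stab = stab
  stab_proj : stab * proj .s = stab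
  proj_cent : proj .c * cent = cent
  cent_proj : cent * proj .c = cent
  proj_centInv : proj .c * centInv = centInv
  centInv_proj : centInv * proj .c = centInv
  proj_unstInv : proj .u * unstInv = unstInv
  unstInv_proj : unstInv * proj .u = unstInv
  cent_mul_centInv : cent * centInv = proj .c
  centInv_mul_cent : centInv * cent = proj .c
  mem_graph : ∀ x y, (x, y) ∈ A.graph ↔
    proj .s y = stab x ∧ proj .c y = cent x ∧ proj .u x = unstInv y

/-- The operator induced by `L` on the range of an idempotent `p` with `p L = L`. -/
def restrictRange (p L : X →L[𝕜] X) (h : p * L = L) : p.range →L[𝕜] p.range :=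
  (L ∘L p.range.subtypeL).codRestrict p.range fun x => ⟨L x, DFunLike.congr_fun h (x : X)⟩

/-! ### From a trichotomic splitting to a block form. -/

namespace TrichotomicSplitting

variable {A : X →ₗ.[𝕜] X} (T : TrichotomicSplitting A)

theorem extend_apply (k : TriLabel) (L : T.space k →L[𝕜] T.space k) (x : X) :
    T.extend k L x = L ⟨T.proj k x, x, rfl⟩ := rfl

theorem proj_mem (k : TriLabel) (x : X) : T.proj k x ∈ T.space k := ⟨x, rfl⟩

theorem proj_apply_of_mem {k : TriLabel} {x : X} (hx : x ∈ T.space k) : T.proj k x = x :=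
  (mem_range_iff_of_idem (T.proj_idem k)).1 hx

theorem extend_apply_of_mem {k : TriLabel} (L : T.space k →L[𝕜] T.space k) {x : X}
    (hx : x ∈ T.space k) : T.extend k L x = L ⟨x, hx⟩ := by
  rw [extend_apply]
  congr 2
  exact Subtype.ext (T.proj_apply_of_mem hx)

theorem extend_mem (k : TriLabel) (L : T.space k →L[𝕜] T.space k) (x : X) :
    T.extend k L x ∈ T.space k := (L _).2

theorem proj_mul_extend (k : TriLabel) (L : T.space k →L[𝕜] T.space k) :
    T.proj k * T.extend k L = T.extend k L :=
  ContinuousLinearMap.ext fun x => T.proj_apply_of_mem (T.extend_mem k L x)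

theorem extend_mul_proj (k : TriLabel) (L : T.space k →L[𝕜] T.space k) :
    T.extend k L * T.proj k = T.extend k L :=
  ContinuousLinearMap.ext fun x => by
    change T.extend k L (T.proj k x) = _
    rw [T.extend_apply_of_mem L (T.proj_mem k x), extend_apply]

theorem extend_one (k : TriLabel) : T.extend k 1 = T.proj k := rfl

theorem extend_mul (k : TriLabel) (L M : T.space k →L[𝕜] T.space k) :
    T.extend k (L * M) = T.extend k L * T.extend k M :=
  ContinuousLinearMap.ext fun x => by
    change _ = T.extend k L (T.extend k M x)
    rw [T.extend_apply_of_mem L (T.extend_mem k M x), extend_apply]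
    rfl

theorem extend_pow (k : TriLabel) (L : T.space k →L[𝕜] T.space k) (n : ℕ) :
    T.extend k (L ^ n) = T.extend k L ^ n * T.proj k := by
  induction n with
  | zero => simp [extend_one]
  | succ n ih => rw [pow_succ', extend_mul, ih, pow_succ', mul_assoc]

theorem centralPow_natCast (n : ℕ) :
    T.centralPow n = (T.central : T.space .c →L[𝕜] T.space .c) ^ n := by
  induction n with
  | zero => rfl
  | succ n ih =>
    rw [pow_succ, ← ih]
    unfold centralPow
    push_cast
    rw [zpow_add, zpow_one]
    rfl

theorem centralPow_neg_natCast (n : ℕ) :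
    T.centralPow (-n) = (T.central.symm : T.space .c →L[𝕜] T.space .c) ^ n := by
  induction n with
  | zero => rfl
  | succ n ih =>
    rw [pow_succ, ← ih]
    unfold centralPow
    push_cast
    rw [neg_add, zpow_add, zpow_neg_one]
    rfl

/-- $X_k$ is contained in the range of $I - \Pi_j$, which the idempotent $\Pi_j$ annihilates. -/
theorem proj_mul_of_ne (j k : TriLabel) (h : j ≠ k) : T.proj j * T.proj k = 0 := by
  ext x
  have hx : T.proj k x ∈ (ContinuousLinearMap.id 𝕜 X - T.proj j).range := by
    rw [T.range_compl j]
    exact (le_iSup₂_of_le (f := fun i (_ : i ≠ j) => (T.proj i).range) k h.symm le_rfl) ⟨x, rfl⟩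
  obtain ⟨y, hy⟩ := hx
  change T.proj j (T.proj k x) = 0
  rw [← hy]
  change T.proj j (y - T.proj j y) = 0
  rw [map_sub, T.proj_apply_of_mem (T.proj_mem j y), sub_self]

theorem proj_apply_of_ne {j k : TriLabel} (h : j ≠ k) {x : X} (hx : x ∈ T.space k) :
    T.proj j x = 0 := by
  rw [← T.proj_apply_of_mem hx]
  exact DFunLike.congr_fun (T.proj_mul_of_ne j k h) x

theorem sum_proj : T.proj .s + T.proj .c + T.proj .u = 1 := by
  ext x
  have hx : x ∈ ⨆ k, (T.proj k).range := by rw [T.spanning]; trivial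
  refine Submodule.iSup_induction _ (motive := fun x =>
    (T.proj .s + T.proj .c + T.proj .u) x = (1 : X →L[𝕜] X) x) hx ?_ (by simp) ?_
  · intro k x hx
    change T.proj .s x + T.proj .c x + T.proj .u x = x
    cases k
    · rw [T.proj_apply_of_mem hx, T.proj_apply_of_ne (by simp) hx,
        T.proj_apply_of_ne (by simp) hx, add_zero, add_zero]
    · rw [T.proj_apply_of_mem hx, T.proj_apply_of_ne (by simp) hx,
        T.proj_apply_of_ne (by simp) hx, add_zero, zero_add]
    · rw [T.proj_apply_of_mem hx, T.proj_apply_of_ne (by simp) hx,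
        T.proj_apply_of_ne (by simp) hx, add_zero, zero_add]
  · intro x y hx hy
    rw [map_add, map_add, hx, hy]

theorem proj_decomp (x : X) : T.proj .s x + T.proj .c x + T.proj .u x = x :=
  DFunLike.congr_fun T.sum_proj x

theorem stable_graph (x : X) : (T.proj .s x, T.extend .s T.stable x) ∈ A.graph := by
  rw [extend_apply]
  refine (mem_graph_partIn A (T.proj .s).range ⟨T.proj .s x, x, rfl⟩ _).1 ?_
  rw [T.stable_eq]
  exact (mem_graph_toPMap_top _ _ _).2 rfl

theorem central_graph (x : X) :
    (T.proj .c x, T.extend .c (T.central : T.space .c →L[𝕜] T.space .c) x) ∈ A.graph := by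
  rw [extend_apply]
  refine (mem_graph_partIn A (T.proj .c).range ⟨T.proj .c x, x, rfl⟩ _).1 ?_
  rw [T.central_eq]
  exact (mem_graph_toPMap_top _ _ _).2 rfl

theorem unstable_graph (y : X) : (T.extend .u T.unstableInv y, T.proj .u y) ∈ A.graph := by
  rw [extend_apply]
  refine (mem_graph_partIn A (T.proj .u).range _ ⟨T.proj .u y, y, rfl⟩).1 ?_
  have h := LinearPMap.mem_graph (partIn A (T.proj .u).range) ⟨_, T.unstableInv_mem ⟨T.proj .u y, y, rfl⟩⟩
  rwa [T.unstable_right] at h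

theorem unstable_eq_of_graph {x y : X} (hx : x ∈ T.space .u) (hy : y ∈ T.space .u)
    (h : (x, y) ∈ A.graph) : T.extend .u T.unstableInv y = x := by
  rw [T.extend_apply_of_mem _ hy]
  obtain ⟨w, hw, hwy⟩ := (LinearPMap.mem_graph_iff _).1
    ((mem_graph_partIn A (T.proj .u).range ⟨x, hx⟩ ⟨y, hy⟩).2 h)
  dsimp only at hw hwy
  rw [← hwy]
  refine (congrArg Subtype.val (T.unstable_left w)).trans (congrArg Subtype.val hw)

/-- $X_s$ and $X_c$ lie entirely in $D(A)$, so the unstable component is a difference of elements of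
$D(A)$. -/
theorem proj_mem_domain {x : X} (hx : x ∈ A.domain) (k : TriLabel) : T.proj k x ∈ A.domain := by
  have hs : T.proj .s x ∈ A.domain := LinearPMap.mem_domain_iff.2 ⟨_, T.stable_graph x⟩
  have hc : T.proj .c x ∈ A.domain := LinearPMap.mem_domain_iff.2 ⟨_, T.central_graph x⟩
  cases k
  · exact hs
  · exact hc
  · have h : T.proj .u x = x - (T.proj .s x + T.proj .c x) := by
      rw [eq_sub_iff_add_eq', T.proj_decomp]
    rw [h]
    exact sub_mem hx (add_mem hs hc)

/-- The block form of a trichotomic splitting. -/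
def toBlockForm : BlockForm A where
  proj := T.proj
  proj_idem := T.proj_idem
  proj_mul_of_ne := T.proj_mul_of_ne
  sum_proj := T.sum_proj
  stab := T.extend .s T.stable
  cent := T.extend .c (T.central : T.space .c →L[𝕜] T.space .c)
  centInv := T.extend .c (T.central.symm : T.space .c →L[𝕜] T.space .c)
  unstInv := T.extend .u T.unstableInv
  proj_stab := T.proj_mul_extend _ _
  stab_proj := T.extend_mul_proj _ _
  proj_cent := T.proj_mul_extend _ _
  cent_proj := T.extend_mul_proj _ _
  proj_centInv := T.proj_mul_extend _ _
  centInv_proj := T.extend_mul_proj _ _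
  proj_unstInv := T.proj_mul_extend _ _
  unstInv_proj := T.extend_mul_proj _ _
  cent_mul_centInv := by
    rw [← extend_mul]
    refine (congrArg (T.extend .c) ?_).trans (T.extend_one .c)
    ext x
    simp
  centInv_mul_cent := by
    rw [← extend_mul]
    refine (congrArg (T.extend .c) ?_).trans (T.extend_one .c)
    ext x
    simp
  mem_graph := by
    intro x y
    constructor
    · intro h
      have hx : x ∈ A.domain := LinearPMap.mem_domain_iff.2 ⟨y, h⟩
      have hu := LinearPMap.mem_graph A ⟨_, T.proj_mem_domain hx .u⟩
      have hur := T.invariant .u ⟨_, T.proj_mem_domain hx .u⟩ ⟨x, rfl⟩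
      set z := A ⟨_, T.proj_mem_domain hx .u⟩ with hz
      -- $A$ is evaluated on the three components of $x$; single-valuedness identifies $y$ with the
      -- sum, and each projector then isolates one term.
      have hsum := add_mem (add_mem (T.stable_graph x) (T.central_graph x)) hu
      simp only [Prod.mk_add_mk] at hsum
      have hy := A.mem_graph_snd_inj h hsum (T.proj_decomp x).symm
      have hs := T.extend_mem .s T.stable x
      have hc := T.extend_mem .c (T.central : T.space .c →L[𝕜] T.space .c) x
      refine ⟨?_, ?_, ?_⟩
      · rw [hy, map_add, map_add, T.proj_apply_of_mem hs, T.proj_apply_of_ne (by simp) hc,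
          T.proj_apply_of_ne (by simp) hur, add_zero, add_zero]
      · rw [hy, map_add, map_add, T.proj_apply_of_mem hc, T.proj_apply_of_ne (by simp) hs,
          T.proj_apply_of_ne (by simp) hur, add_zero, zero_add]
      · have hyz : T.proj .u y = z := by
          rw [hy, map_add, map_add, T.proj_apply_of_ne (by simp) hs,
            T.proj_apply_of_ne (by simp) hc, T.proj_apply_of_mem hur, add_zero, zero_add]
        rw [← DFunLike.congr_fun (T.extend_mul_proj .u T.unstableInv) y]
        change _ = T.extend .u T.unstableInv (T.proj .u y)
        rw [hyz]
        exact (T.unstable_eq_of_graph ⟨x, rfl⟩ hur hu).symm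
    · rintro ⟨hs, hc, hu⟩
      have hsum := add_mem (add_mem (T.stable_graph x) (T.central_graph x)) (T.unstable_graph y)
      simp only [Prod.mk_add_mk] at hsum
      rwa [← hs, ← hc, ← hu, T.proj_decomp, T.proj_decomp] at hsum

theorem stableEvol_eq (n : ℕ) :
    T.stableEvol n = T.toBlockForm.stab ^ n * T.toBlockForm.proj .s := T.extend_pow _ _ n

theorem unstableEvol_eq (n : ℕ) :
    T.unstableEvol n = T.toBlockForm.unstInv ^ n * T.toBlockForm.proj .u := T.extend_pow _ _ n

theorem centralEvol_natCast (n : ℕ) :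
    T.centralEvol n = T.toBlockForm.cent ^ n * T.toBlockForm.proj .c := by
  rw [centralEvol, centralPow_natCast]
  exact T.extend_pow _ _ n

theorem centralEvol_neg_natCast (n : ℕ) :
    T.centralEvol (-n) = T.toBlockForm.centInv ^ n * T.toBlockForm.proj .c := by
  rw [centralEvol, centralPow_neg_natCast]
  exact T.extend_pow _ _ n

end TrichotomicSplitting

/-! ### From a block form back to a trichotomic splitting. -/

namespace BlockForm

variable {A : X →ₗ.[𝕜] X} (b : BlockForm A)

theorem proj_mem (k : TriLabel) (x : X) : b.proj k x ∈ (b.proj k).range := ⟨x, rfl⟩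

theorem proj_apply_of_mem {k : TriLabel} {x : X} (hx : x ∈ (b.proj k).range) : b.proj k x = x :=
  (mem_range_iff_of_idem (b.proj_idem k)).1 hx

theorem proj_apply_of_ne {j k : TriLabel} (h : j ≠ k) {x : X} (hx : x ∈ (b.proj k).range) :
    b.proj j x = 0 := by
  rw [← b.proj_apply_of_mem hx]
  exact DFunLike.congr_fun (b.proj_mul_of_ne j k h) x

theorem proj_decomp (x : X) : b.proj .s x + b.proj .c x + b.proj .u x = x :=
  DFunLike.congr_fun b.sum_proj x

theorem stab_apply (x : X) : b.stab (b.proj .s x) = b.stab x := DFunLike.congr_fun b.stab_proj x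
theorem cent_apply (x : X) : b.cent (b.proj .c x) = b.cent x := DFunLike.congr_fun b.cent_proj x
theorem unstInv_apply (x : X) : b.unstInv (b.proj .u x) = b.unstInv x :=
  DFunLike.congr_fun b.unstInv_proj x

theorem stab_mem (x : X) : b.stab x ∈ (b.proj .s).range := ⟨_, DFunLike.congr_fun b.proj_stab x⟩
theorem cent_mem (x : X) : b.cent x ∈ (b.proj .c).range := ⟨_, DFunLike.congr_fun b.proj_cent x⟩
theorem unstInv_mem (x : X) : b.unstInv x ∈ (b.proj .u).range :=
  ⟨_, DFunLike.congr_fun b.proj_unstInv x⟩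

theorem stab_apply_of_ne {k : TriLabel} (h : .s ≠ k) {x : X} (hx : x ∈ (b.proj k).range) :
    b.stab x = 0 := by rw [← b.stab_apply, b.proj_apply_of_ne h hx, map_zero]
theorem cent_apply_of_ne {k : TriLabel} (h : .c ≠ k) {x : X} (hx : x ∈ (b.proj k).range) :
    b.cent x = 0 := by rw [← b.cent_apply, b.proj_apply_of_ne h hx, map_zero]
theorem unstInv_apply_of_ne {k : TriLabel} (h : .u ≠ k) {x : X} (hx : x ∈ (b.proj k).range) :
    b.unstInv x = 0 := by rw [← b.unstInv_apply, b.proj_apply_of_ne h hx, map_zero]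

theorem mem_graph_stable {x y : X} (hx : x ∈ (b.proj .s).range) (hy : y ∈ (b.proj .s).range) :
    (x, y) ∈ A.graph ↔ b.stab x = y := by
  rw [b.mem_graph, b.proj_apply_of_mem hy, b.proj_apply_of_ne (by simp) hy,
    b.cent_apply_of_ne (by simp) hx, b.proj_apply_of_ne (by simp) hx,
    b.unstInv_apply_of_ne (by simp) hy]
  simp [eq_comm]

theorem mem_graph_central {x y : X} (hx : x ∈ (b.proj .c).range) (hy : y ∈ (b.proj .c).range) :
    (x, y) ∈ A.graph ↔ b.cent x = y := by
  rw [b.mem_graph, b.proj_apply_of_mem hy, b.proj_apply_of_ne (by simp) hy,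
    b.stab_apply_of_ne (by simp) hx, b.proj_apply_of_ne (by simp) hx,
    b.unstInv_apply_of_ne (by simp) hy]
  simp [eq_comm]

theorem mem_graph_unstable {x y : X} (hx : x ∈ (b.proj .u).range) (hy : y ∈ (b.proj .u).range) :
    (x, y) ∈ A.graph ↔ b.unstInv y = x := by
  rw [b.mem_graph, b.proj_apply_of_mem hx, b.proj_apply_of_ne (by simp) hy,
    b.stab_apply_of_ne (by simp) hx, b.proj_apply_of_ne (by simp) hy,
    b.cent_apply_of_ne (by simp) hx]
  simp [eq_comm]

theorem proj_unst_graph {x y : X} (h : (x, y) ∈ A.graph) :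
    (b.proj .u x, b.proj .u y) ∈ A.graph := by
  rw [b.mem_graph_unstable (b.proj_mem .u x) (b.proj_mem .u y), b.unstInv_apply]
  exact ((b.mem_graph x y).1 h).2.2.symm

theorem stab_graph (x : X) : (b.proj .s x, b.stab x) ∈ A.graph := by
  rw [b.mem_graph_stable (b.proj_mem .s x) (b.stab_mem x), b.stab_apply]

theorem cent_graph (x : X) : (b.proj .c x, b.cent x) ∈ A.graph := by
  rw [b.mem_graph_central (b.proj_mem .c x) (b.cent_mem x), b.cent_apply]

theorem unstInv_graph (y : X) : (b.unstInv y, b.proj .u y) ∈ A.graph := by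
  rw [b.mem_graph_unstable (b.unstInv_mem y) (b.proj_mem .u y), b.unstInv_apply]

theorem _root_.range_id_sub_eq_sup {p q r : X →L[𝕜] X} (hpq : p * q = 0) (hpr : p * r = 0)
    (h : p + q + r = 1) : (ContinuousLinearMap.id 𝕜 X - p).range = q.range ⊔ r.range := by
  apply le_antisymm
  · rintro _ ⟨x, rfl⟩
    have hx : x - p x = q x + r x := by
      rw [sub_eq_iff_eq_add', ← add_assoc]
      exact (DFunLike.congr_fun h x).symm
    change x - p x ∈ _
    rw [hx]
    exact Submodule.add_mem_sup ⟨x, rfl⟩ ⟨x, rfl⟩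
  · refine sup_le ?_ ?_
    · rintro _ ⟨x, rfl⟩
      refine ⟨q x, ?_⟩
      change q x - (p * q) x = q x
      rw [hpq]; simp
    · rintro _ ⟨x, rfl⟩
      refine ⟨r x, ?_⟩
      change r x - (p * r) x = r x
      rw [hpr]; simp

theorem range_compl (k : TriLabel) :
    (ContinuousLinearMap.id 𝕜 X - b.proj k).range = ⨆ j ≠ k, (b.proj j).range := by
  have hsum := b.sum_proj
  apply le_antisymm
  · have key : ∀ i j : TriLabel, i ≠ k → j ≠ k → b.proj k + b.proj i + b.proj j = 1 →
        (ContinuousLinearMap.id 𝕜 X - b.proj k).range ≤ ⨆ j ≠ k, (b.proj j).range := by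
      intro i j hi hj h
      rw [range_id_sub_eq_sup (b.proj_mul_of_ne k i hi.symm)
        (b.proj_mul_of_ne k j hj.symm) h]
      exact sup_le (le_iSup₂_of_le (f := fun i (_ : i ≠ k) => (b.proj i).range) i hi le_rfl)
        (le_iSup₂_of_le (f := fun i (_ : i ≠ k) => (b.proj i).range) j hj le_rfl)
    cases k
    · exact key .c .u (by simp) (by simp) hsum
    · exact key .s .u (by simp) (by simp) (by rw [← hsum]; abel)
    · exact key .s .c (by simp) (by simp) (by rw [← hsum]; abel)
  · refine iSup₂_le fun j hj => ?_
    rintro _ ⟨x, rfl⟩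
    refine ⟨b.proj j x, ?_⟩
    change b.proj j x - (b.proj k * b.proj j) x = b.proj j x
    rw [b.proj_mul_of_ne k j hj.symm]; simp

theorem independent : iSupIndep fun k => (b.proj k).range := by
  intro k
  rw [Submodule.disjoint_def]
  intro x hx hx'
  rw [← b.range_compl k] at hx'
  obtain ⟨y, rfl⟩ := hx'
  have h := b.proj_apply_of_mem hx
  change b.proj k (y - b.proj k y) = _ at h
  rw [map_sub, b.proj_apply_of_mem (b.proj_mem k y), sub_self] at h
  exact h.symm

theorem spanning : ⨆ k, (b.proj k).range = ⊤ := by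
  rw [eq_top_iff]
  intro x _
  rw [← b.proj_decomp x]
  have h : ∀ k, b.proj k x ∈ ⨆ k, (b.proj k).range := fun k =>
    le_iSup (fun k => (b.proj k).range) k ⟨x, rfl⟩
  exact add_mem (add_mem (h _) (h _)) (h _)

theorem invariant (k : TriLabel) (x : A.domain) (hx : (x : X) ∈ (b.proj k).range) :
    A x ∈ (b.proj k).range := by
  have hg := LinearPMap.mem_graph A x
  obtain ⟨hs, hc, hu⟩ := (b.mem_graph _ _).1 hg
  have hu' := b.proj_unst_graph hg
  have hd := b.proj_decomp (A x)
  -- Here $\Pi_u x = 0$, so $(0, \Pi_u A x)$ is in the graph of $A$.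
  have hz : k ≠ .u → b.proj .u (A x) = 0 := fun hk => by
    rw [b.proj_apply_of_ne hk.symm hx] at hu'
    exact A.mem_graph_snd_inj hu' (zero_mem A.graph) rfl
  cases k
  · rw [hs, hc, b.cent_apply_of_ne (by simp) hx, hz (by simp), add_zero, add_zero] at hd
    rw [← hd]; exact b.stab_mem _
  · rw [hs, hc, b.stab_apply_of_ne (by simp) hx, hz (by simp), add_zero, zero_add] at hd
    rw [← hd]; exact b.cent_mem _
  · rw [hs, hc, b.stab_apply_of_ne (by simp) hx, b.cent_apply_of_ne (by simp) hx, add_zero,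
      zero_add] at hd
    rw [← hd]; exact ⟨_, rfl⟩

theorem domain_eq : A.domain =
    (b.proj .s).range ⊔ (b.proj .c).range ⊔ (A.domain ⊓ (b.proj .u).range) := by
  apply le_antisymm
  · intro x hx
    obtain ⟨y, hy⟩ := LinearPMap.mem_domain_iff.1 hx
    rw [← b.proj_decomp x]
    exact Submodule.add_mem_sup (Submodule.add_mem_sup ⟨x, rfl⟩ ⟨x, rfl⟩)
      ⟨LinearPMap.mem_domain_iff.2 ⟨_, b.proj_unst_graph hy⟩, x, rfl⟩
  · refine sup_le (sup_le ?_ ?_) inf_le_left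
    · rintro _ ⟨x, rfl⟩
      exact LinearPMap.mem_domain_iff.2 ⟨_, b.stab_graph x⟩
    · rintro _ ⟨x, rfl⟩
      exact LinearPMap.mem_domain_iff.2 ⟨_, b.cent_graph x⟩

/-- The three graph equations involve only continuous maps, so closedness of $A + B$ needs no
separate argument. -/
theorem isClosed {A : X →ₗ.[𝕜] X} (b : BlockForm A) : A.IsClosed := by
  have h : (A.graph : Set (X × X)) = {z | b.proj .s z.2 = b.stab z.1} ∩
      ({z | b.proj .c z.2 = b.cent z.1} ∩ {z | b.proj .u z.1 = b.unstInv z.2}) := by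
    ext ⟨x, y⟩
    exact b.mem_graph x y
  change IsClosed (A.graph : Set (X × X))
  rw [h]
  exact (isClosed_eq (by fun_prop) (by fun_prop)).inter
    ((isClosed_eq (by fun_prop) (by fun_prop)).inter (isClosed_eq (by fun_prop) (by fun_prop)))

/-- The trichotomic splitting determined by a block form. -/
def toSplitting : TrichotomicSplitting A where
  isClosed := b.isClosed
  proj := b.proj
  proj_idem := b.proj_idem
  independent := b.independent
  spanning := b.spanning
  range_compl := b.range_compl
  domain_eq := b.domain_eq
  invariant := b.invariant
  stable := restrictRange _ _ b.proj_stab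
  stable_eq := by
    apply LinearPMap.eq_of_eq_graph
    ext ⟨x, y⟩
    rw [mem_graph_partIn, mem_graph_toPMap_top, b.mem_graph_stable x.2 y.2, Subtype.ext_iff]
    rfl
  central := ContinuousLinearEquiv.equivOfInverse (restrictRange _ _ b.proj_cent)
    (restrictRange _ _ b.proj_centInv)
    (fun x => Subtype.ext ((DFunLike.congr_fun b.centInv_mul_cent (x : X)).trans
      (b.proj_apply_of_mem x.2)))
    (fun x => Subtype.ext ((DFunLike.congr_fun b.cent_mul_centInv (x : X)).trans
      (b.proj_apply_of_mem x.2)))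
  central_eq := by
    apply LinearPMap.eq_of_eq_graph
    ext ⟨x, y⟩
    rw [mem_graph_partIn, mem_graph_toPMap_top, b.mem_graph_central x.2 y.2, Subtype.ext_iff]
    rfl
  unstableInv := restrictRange _ _ b.proj_unstInv
  unstableInv_mem := fun y => LinearPMap.mem_domain_iff.2 ⟨y, by
    rw [mem_graph_partIn, b.mem_graph_unstable (Subtype.coe_prop _) y.2]; rfl⟩
  unstable_right := fun y => by
    symm
    rw [LinearPMap.image_iff, mem_graph_partIn, b.mem_graph_unstable (Subtype.coe_prop _) y.2]
    rfl
  unstable_left := fun x => by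
    have h := LinearPMap.mem_graph (partIn A (b.proj .u).range) x
    rw [mem_graph_partIn, b.mem_graph_unstable (Subtype.coe_prop _) (Subtype.coe_prop _)] at h
    exact Subtype.ext h

theorem toSplitting_stableEvol (n : ℕ) :
    b.toSplitting.stableEvol n = b.stab ^ n * b.proj .s := by
  rw [TrichotomicSplitting.stableEvol, TrichotomicSplitting.extend_pow]
  congr 2
  exact b.stab_proj

theorem toSplitting_unstableEvol (n : ℕ) :
    b.toSplitting.unstableEvol n = b.unstInv ^ n * b.proj .u := by
  rw [TrichotomicSplitting.unstableEvol, TrichotomicSplitting.extend_pow]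
  congr 2
  exact b.unstInv_proj

theorem toSplitting_centralEvol_natCast (n : ℕ) :
    b.toSplitting.centralEvol n = b.cent ^ n * b.proj .c := by
  rw [TrichotomicSplitting.centralEvol, TrichotomicSplitting.centralPow_natCast,
    TrichotomicSplitting.extend_pow]
  congr 2
  exact b.cent_proj

theorem toSplitting_centralEvol_neg_natCast (n : ℕ) :
    b.toSplitting.centralEvol (-n) = b.centInv ^ n * b.proj .c := by
  rw [TrichotomicSplitting.centralEvol, TrichotomicSplitting.centralPow_neg_natCast,
    TrichotomicSplitting.extend_pow]
  congr 2
  exact b.centInv_proj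

end BlockForm

end Blocks


/-! ### Estimates in a normed ring: perturbed powers, Neumann series, a quadratic fixed point. -/

section Rings

variable {R : Type*} [NormedRing R]

/-- Discrete Duhamel (variation of constants) formula. -/
theorem pow_add_mul_eq_sum (T E p : R) (n : ℕ) :
    (T + E) ^ n * p = T ^ n * p +
      ∑ j ∈ Finset.range n, T ^ (n - 1 - j) * E * ((T + E) ^ j * p) := by
  induction n with
  | zero => simp
  | succ n ih =>
    have h : ∑ j ∈ Finset.range n, T ^ (n + 1 - 1 - j) * E * ((T + E) ^ j * p) =
        T * ∑ j ∈ Finset.range n, T ^ (n - 1 - j) * E * ((T + E) ^ j * p) := by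
      rw [Finset.mul_sum]
      refine Finset.sum_congr rfl fun j hj => ?_
      have hj' := Finset.mem_range.1 hj
      rw [show n + 1 - 1 - j = (n - 1 - j) + 1 by omega, pow_succ']
      simp only [mul_assoc]
    rw [Finset.sum_range_succ, h, pow_succ', mul_assoc, add_mul]
    nth_rewrite 1 [ih]
    rw [show n + 1 - 1 - n = 0 by omega, pow_succ']
    simp only [pow_zero, one_mul, mul_add, mul_assoc]
    abel

/-- Strong induction on the Duhamel formula: $K(r+Ke)^n$ satisfies the corresponding scalar
recursion with equality. The identity $pE = E$ allows $p$ to be inserted before $E$, where the bound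
on $T^n p$ applies. -/
theorem norm_pow_add_mul_sub_le {T E p : R} {K r e : ℝ} (hK : 0 ≤ K) (hr : 0 ≤ r) (he : 0 ≤ e)
    (hT : ∀ n : ℕ, ‖T ^ n * p‖ ≤ K * r ^ n) (hpE : p * E = E) (hE : ‖E‖ ≤ e) (n : ℕ) :
    ‖(T + E) ^ n * p - T ^ n * p‖ ≤ K * ((r + K * e) ^ n - r ^ n) := by
  induction n using Nat.strong_induction_on with
  | _ n ih =>
    have hb : ∀ j < n, ‖(T + E) ^ j * p‖ ≤ K * (r + K * e) ^ j := fun j hj => by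
      have h1 := norm_add_le ((T + E) ^ j * p - T ^ j * p) (T ^ j * p)
      rw [sub_add_cancel] at h1
      have h2 := ih j hj
      have h3 := hT j
      linarith
    rw [pow_add_mul_eq_sum, add_sub_cancel_left]
    have hg := (Commute.all (r + K * e) r).geom_sum₂_mul n
    rw [← hg, add_sub_cancel_left, Finset.sum_mul, Finset.mul_sum]
    refine norm_sum_le_of_le _ fun j hj => ?_
    have hTE : T ^ (n - 1 - j) * E = T ^ (n - 1 - j) * p * E := by rw [mul_assoc, hpE]
    rw [hTE]
    calc ‖T ^ (n - 1 - j) * p * E * ((T + E) ^ j * p)‖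
        ≤ ‖T ^ (n - 1 - j) * p‖ * ‖E‖ * ‖(T + E) ^ j * p‖ :=
          (norm_mul_le _ _).trans (by gcongr; exact norm_mul_le _ _)
      _ ≤ (K * r ^ (n - 1 - j)) * e * (K * (r + K * e) ^ j) := by
          gcongr
          · exact hT _
          · exact hb j (Finset.mem_range.1 hj)
      _ = K * ((r + K * e) ^ j * r ^ (n - 1 - j) * (K * e)) := by ring

/-- Factor both $(r+x)^n - r^n$ and $r'^n - r^n$ as geometric sums and compare termwise. Giving up
the gap $r' - r$ makes the bound linear in $x$, uniformly in $n$. -/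
theorem pow_add_sub_pow_le {r r' x : ℝ} (hr : 0 ≤ r) (hrr' : r < r') (hx : 0 ≤ x)
    (hx' : x ≤ r' - r) (n : ℕ) : (r + x) ^ n - r ^ n ≤ x / (r' - r) * r' ^ n := by
  have hg : 0 < r' - r := sub_pos.2 hrr'
  have h1 := (Commute.all (r + x) r).geom_sum₂_mul n
  have h2 := (Commute.all r' r).geom_sum₂_mul n
  rw [add_sub_cancel_left] at h1
  have h3 : ∑ i ∈ Finset.range n, (r + x) ^ i * r ^ (n - 1 - i) ≤
      ∑ i ∈ Finset.range n, r' ^ i * r ^ (n - 1 - i) := by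
    gcongr
    linarith
  have h4 : ∑ i ∈ Finset.range n, r' ^ i * r ^ (n - 1 - i) ≤ r' ^ n / (r' - r) := by
    rw [le_div_iff₀ hg, h2]
    have : 0 ≤ r ^ n := by positivity
    linarith
  rw [← h1]
  calc _ ≤ r' ^ n / (r' - r) * x := by
        gcongr
        exact h3.trans h4
    _ = _ := by ring

theorem norm_pow_add_mul_sub_le_of_lt {T E p : R} {K r r' e : ℝ} (hK : 0 ≤ K) (hr : 0 ≤ r)
    (he : 0 ≤ e) (hrr' : r < r') (hKe : K * e ≤ r' - r)
    (hT : ∀ n : ℕ, ‖T ^ n * p‖ ≤ K * r ^ n) (hpE : p * E = E) (hE : ‖E‖ ≤ e) (n : ℕ) :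
    ‖(T + E) ^ n * p - T ^ n * p‖ ≤ K * (K * e / (r' - r)) * r' ^ n := by
  refine (norm_pow_add_mul_sub_le hK hr he hT hpE hE n).trans ?_
  rw [mul_assoc]
  gcongr
  exact pow_add_sub_pow_le hr hrr' (by positivity) hKe n

theorem norm_mul_mul_inv_sub_le {H Wi Y : R} {h : ℝ} (hWi : (1 + H) * Wi = 1) (hH : ‖H‖ ≤ h)
    (hWin : ‖Wi‖ ≤ 3 / 2) : ‖(1 + H) * Y * Wi - Y‖ ≤ 3 * h * ‖Y‖ := by
  have h0 : 0 ≤ h := (norm_nonneg _).trans hH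
  -- The conjugation error is a commutator with $H$.
  have e1 : (1 + H) * Y * Wi - Y = (H * Y - Y * H) * Wi := by
    calc (1 + H) * Y * Wi - Y = (1 + H) * Y * Wi - Y * ((1 + H) * Wi) := by rw [hWi, mul_one]
      _ = _ := by noncomm_ring
  rw [e1]
  calc ‖(H * Y - Y * H) * Wi‖ ≤ (‖H‖ * ‖Y‖ + ‖Y‖ * ‖H‖) * ‖Wi‖ :=
        (norm_mul_le _ _).trans (by
          gcongr
          exact (norm_sub_le _ _).trans (add_le_add (norm_mul_le _ _) (norm_mul_le _ _)))
    _ ≤ (h * ‖Y‖ + ‖Y‖ * h) * (3 / 2) := by gcongr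
    _ = _ := by ring

/-- Neumann series. Assuming only $\|1\| \le 1$ admits the operators on the zero space, where $\|1\|
= 0$. -/
theorem exists_unit_one_add [CompleteSpace R] (h1 : ‖(1 : R)‖ ≤ 1) {Z : R} {z : ℝ} (hZ : ‖Z‖ ≤ z) (hz : z ≤ 1 / 2) :
    ∃ w : Rˣ, (w : R) = 1 + Z ∧ ‖(↑w⁻¹ : R)‖ ≤ 1 / (1 - z) := by
  have hlt : ‖-Z‖ < 1 := by rw [norm_neg]; linarith
  refine ⟨Units.oneSub (-Z) hlt, by simp, ?_⟩
  set w := Units.oneSub (-Z) hlt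
  have hw : (w : R) = 1 + Z := by simp [w]
  have e : (↑w⁻¹ : R) = 1 - Z * ↑w⁻¹ := by
    rw [eq_sub_iff_add_eq]
    calc (↑w⁻¹ : R) + Z * ↑w⁻¹ = (1 + Z) * ↑w⁻¹ := by noncomm_ring
      _ = 1 := by rw [← hw, Units.mul_inv]
  have h2 : ‖(↑w⁻¹ : R)‖ ≤ 1 + z * ‖(↑w⁻¹ : R)‖ := by
    calc ‖(↑w⁻¹ : R)‖ = ‖1 - Z * ↑w⁻¹‖ := by rw [← e]
      _ ≤ ‖(1 : R)‖ + ‖Z‖ * ‖(↑w⁻¹ : R)‖ :=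
        (norm_sub_le _ _).trans (add_le_add le_rfl (norm_mul_le _ _))
      _ ≤ _ := by gcongr
  rw [le_div_iff₀ (by linarith)]
  linarith

theorem summable_sandwich [CompleteSpace R] {P Q : ℕ → R} {K θ : ℝ} (hθ0 : 0 ≤ θ) (hθ : θ < 1)
    (hPQ : ∀ n, ‖P n‖ * ‖Q n‖ ≤ K * θ ^ n) (F : R) :
    Summable fun n => P n * F * Q n := by
  refine Summable.of_norm_bounded (g := fun n => K * ‖F‖ * θ ^ n)
    ((summable_geometric_of_lt_one hθ0 hθ).mul_left _) fun n => ?_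
  calc ‖P n * F * Q n‖ ≤ ‖P n‖ * ‖F‖ * ‖Q n‖ :=
        (norm_mul_le _ _).trans (by gcongr; exact norm_mul_le _ _)
    _ = ‖P n‖ * ‖Q n‖ * ‖F‖ := by ring
    _ ≤ K * θ ^ n * ‖F‖ := mul_le_mul_of_nonneg_right (hPQ n) (norm_nonneg _)
    _ = _ := by ring

theorem norm_tsum_sandwich_le {P Q : ℕ → R} {K θ : ℝ} (hθ0 : 0 ≤ θ) (hθ : θ < 1)
    (hPQ : ∀ n, ‖P n‖ * ‖Q n‖ ≤ K * θ ^ n) (F : R) :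
    ‖∑' n, P n * F * Q n‖ ≤ K / (1 - θ) * ‖F‖ := by
  have hs := (hasSum_geometric_of_lt_one hθ0 hθ).mul_left (K * ‖F‖)
  have h := tsum_of_norm_bounded (f := fun n => P n * F * Q n) hs fun n => by
    calc ‖P n * F * Q n‖ ≤ ‖P n‖ * ‖F‖ * ‖Q n‖ :=
          (norm_mul_le _ _).trans (by gcongr; exact norm_mul_le _ _)
      _ = ‖P n‖ * ‖Q n‖ * ‖F‖ := by ring
      _ ≤ K * θ ^ n * ‖F‖ := mul_le_mul_of_nonneg_right (hPQ n) (norm_nonneg _)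
      _ = _ := by ring
  refine h.trans (le_of_eq ?_)
  rw [div_eq_mul_inv]; ring

/-- The map `F ↦ ∑ P n * F * Q n`. -/
noncomputable def sandwichSum (P Q : ℕ → R) (hs : ∀ F, Summable fun n => P n * F * Q n) :
    R →+ R where
  toFun F := ∑' n, P n * F * Q n
  map_zero' := by simp
  map_add' F G := by
    rw [← (hs F).tsum_add (hs G)]
    simp only [mul_add, add_mul]

/-- Banach's fixed point theorem on the closed unit ball. There the map has values of size at most
$2L(m+1)\beta \le 1/3$, and its Lipschitz constant is at most $L(3m+1)\beta \le 1/2$. The value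
bound, applied to the fixed point itself, makes $H$ linear in $\beta$. -/
theorem exists_fixedPoint_quadratic [CompleteSpace R] (Λ dg : R →+ R) {L m β : ℝ} (hL : 0 ≤ L) (hm : 0 ≤ m)
    (hΛ : ∀ F, ‖Λ F‖ ≤ L * ‖F‖) (hdg : ∀ F, ‖dg F‖ ≤ m * ‖F‖) {B : R} (hB : ‖B‖ ≤ β)
    (hβ : 3 * (2 * L * (m + 1)) * β ≤ 1) :
    ∃ H : R, ‖H‖ ≤ 2 * L * (m + 1) * β ∧ Λ (H * dg (B + B * H) - B - B * H) = H := by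
  have hβ0 : 0 ≤ β := (norm_nonneg _).trans hB
  set Φ : R → R := fun H => Λ (H * dg (B + B * H) - B - B * H) with hΦ
  have hBH : ∀ H : R, ‖H‖ ≤ 1 → ‖B * H‖ ≤ β := fun H hH =>
    (norm_mul_le _ _).trans (by nlinarith [norm_nonneg B, norm_nonneg H])
  have hd : ∀ H : R, ‖H‖ ≤ 1 → ‖dg (B + B * H)‖ ≤ m * (2 * β) := fun H hH =>
    (hdg _).trans (by
      gcongr
      have := norm_add_le B (B * H)
      have := hBH H hH
      linarith)
  have hbound : ∀ H : R, ‖H‖ ≤ 1 → ‖Φ H‖ ≤ 2 * L * (m + 1) * β := fun H hH => by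
    have e1 : ‖H * dg (B + B * H)‖ ≤ m * (2 * β) :=
      (norm_mul_le _ _).trans ((mul_le_mul hH (hd H hH) (norm_nonneg _) zero_le_one).trans
        (one_mul _).le)
    have e2 : ‖H * dg (B + B * H) - B - B * H‖ ≤ 2 * (m + 1) * β := by
      have f1 := norm_sub_le (H * dg (B + B * H) - B) (B * H)
      have f2 := norm_sub_le (H * dg (B + B * H)) B
      have f3 := hBH H hH
      linarith
    calc ‖Φ H‖ ≤ L * ‖H * dg (B + B * H) - B - B * H‖ := hΛ _
      _ ≤ L * (2 * (m + 1) * β) := by gcongr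
      _ = _ := by ring
  have hlip : ∀ G H : R, ‖G‖ ≤ 1 → ‖H‖ ≤ 1 → ‖Φ G - Φ H‖ ≤ 1 / 2 * ‖G - H‖ := by
    intro G H hG hH
    have e0 : G * dg (B + B * G) - B - B * G - (H * dg (B + B * H) - B - B * H) =
        (G - H) * dg (B + B * G) + H * dg (B * (G - H)) - B * (G - H) := by
      have : B * (G - H) = (B + B * G) - (B + B * H) := by noncomm_ring
      nth_rewrite 1 [this]
      rw [map_sub]
      noncomm_ring
    have hBG : ‖B * (G - H)‖ ≤ β * ‖G - H‖ := (norm_mul_le _ _).trans (by gcongr)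
    have e1 : ‖(G - H) * dg (B + B * G)‖ ≤ ‖G - H‖ * (m * (2 * β)) :=
      (norm_mul_le _ _).trans (by gcongr; exact hd G hG)
    have e2 : ‖H * dg (B * (G - H))‖ ≤ m * (β * ‖G - H‖) :=
      (norm_mul_le _ _).trans ((mul_le_mul hH ((hdg _).trans (by gcongr)) (norm_nonneg _)
        zero_le_one).trans (one_mul _).le)
    have e3 := norm_sub_le ((G - H) * dg (B + B * G) + H * dg (B * (G - H))) (B * (G - H))
    have e4 := norm_add_le ((G - H) * dg (B + B * G)) (H * dg (B * (G - H)))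
    calc ‖Φ G - Φ H‖ = ‖Λ ((G - H) * dg (B + B * G) + H * dg (B * (G - H)) - B * (G - H))‖ := by
          rw [← e0, map_sub]
      _ ≤ L * ‖(G - H) * dg (B + B * G) + H * dg (B * (G - H)) - B * (G - H)‖ := hΛ _
      _ ≤ L * ((3 * m + 1) * β * ‖G - H‖) := by gcongr; linarith
      _ = L * (3 * m + 1) * β * ‖G - H‖ := by ring
      _ ≤ _ := by
          gcongr
          have : 0 ≤ L * β := by positivity
          nlinarith
  have hmaps : Set.MapsTo Φ (Metric.closedBall 0 1) (Metric.closedBall 0 1) := fun H hH => by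
    rw [mem_closedBall_zero_iff] at hH ⊢
    have := hbound H hH
    nlinarith [(norm_nonneg _).trans this]
  have hcontr : ContractingWith (1 / 2) (hmaps.restrict Φ _ _) := by
    refine ⟨by rw [← NNReal.coe_lt_coe]; norm_num, LipschitzWith.of_dist_le_mul fun G H => ?_⟩
    have := hlip G H (mem_closedBall_zero_iff.1 G.2) (mem_closedBall_zero_iff.1 H.2)
    rw [Subtype.dist_eq, Subtype.dist_eq, dist_eq_norm, dist_eq_norm]
    simpa using this
  obtain ⟨H, hH, hfix, -⟩ := hcontr.exists_fixedPoint' (Metric.isClosed_closedBall.isComplete)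
    hmaps (x := 0) (by simp) (edist_ne_top _ _)
  have hH' := hbound H (mem_closedBall_zero_iff.1 hH)
  rw [hfix.eq] at hH'
  exact ⟨H, hH', hfix⟩

end Rings


/-! ### The Sylvester equation $AH - HA = F - D(F)$, solved block by block. -/

section Sylvester

variable {𝕜 X : Type*} [RCLike 𝕜] [NormedAddCommGroup X] [NormedSpace 𝕜 X]

/-- `Q n` is the `n`-th power of a bounded part of `A`, extended by zero. -/
structure IsForwardFamily (A : X →ₗ.[𝕜] X) (Q : ℕ → X →L[𝕜] X) : Prop where
  succ : ∀ n, Q (n + 1) = Q 1 * Q n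
  zero_mul : ∀ n, Q 0 * Q n = Q n
  mul_zero : ∀ n, Q n * Q 0 = Q n
  graph : ∀ x, (Q 0 x, Q 1 x) ∈ A.graph
  apply_eq : ∀ n x y, (x, y) ∈ A.graph → Q n y = Q (n + 1) x

/-- `P n` is the `-n`-th power of a boundedly invertible part of `A`, extended by zero. -/
structure IsBackwardFamily (A : X →ₗ.[𝕜] X) (P : ℕ → X →L[𝕜] X) : Prop where
  succ : ∀ n, P (n + 1) = P 1 * P n
  zero_mul : ∀ n, P 0 * P n = P n
  mul_zero : ∀ n, P n * P 0 = P n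
  graph : ∀ x, (P 1 x, P 0 x) ∈ A.graph
  apply_eq : ∀ n x y, (x, y) ∈ A.graph → P (n + 1) y = P n x

variable {A : X →ₗ.[𝕜] X} {P Q : ℕ → X →L[𝕜] X}

theorem tsum_sandwich_apply {P Q : ℕ → X →L[𝕜] X} {F : X →L[𝕜] X}
    (hs : Summable fun n => P n * F * Q n) (x : X) :
    (∑' n, P n * F * Q n) x = ∑' n, P n (F (Q n x)) :=
  (ContinuousLinearMap.apply 𝕜 X x).map_tsum hs

theorem summable_sandwich_apply {P Q : ℕ → X →L[𝕜] X} {F : X →L[𝕜] X}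
    (hs : Summable fun n => P n * F * Q n) (x : X) : Summable fun n => P n (F (Q n x)) :=
  hs.mapL (ContinuousLinearMap.apply 𝕜 X x)

section Bounds

variable {K α β : ℝ}

theorem sandwich_bound (hα : 0 ≤ α) (hP : ∀ n, ‖P n‖ ≤ K * α ^ n)
    (hQ : ∀ n, ‖Q n‖ ≤ K * β ^ n) (n : ℕ) : ‖P n‖ * ‖Q n‖ ≤ K ^ 2 * (α * β) ^ n := by
  have hK : 0 ≤ K := by simpa using (norm_nonneg _).trans (hP 0)
  calc ‖P n‖ * ‖Q n‖ ≤ (K * α ^ n) * (K * β ^ n) := by gcongr <;> simp_all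
    _ = _ := by rw [mul_pow]; ring

/-- The solution is $\Lambda F = \sum P_{n+1} F Q_n$. Formally $A\Lambda F = \sum P_n F Q_n$ and
$\Lambda F A = \sum P_{n+1} F Q_{n+1}$, whose difference is $P_0 F Q_0$. -/
theorem exists_sylvester_backward_forward [CompleteSpace X] (hP : IsBackwardFamily A P) (hQ : IsForwardFamily A Q)
    (hα : 0 ≤ α) (hβ : 0 ≤ β) (hαβ : α * β < 1) (hPn : ∀ n, ‖P n‖ ≤ K * α ^ n)
    (hQn : ∀ n, ‖Q n‖ ≤ K * β ^ n) :
    ∃ Λ : (X →L[𝕜] X) →+ (X →L[𝕜] X), (∀ F, ‖Λ F‖ ≤ K ^ 2 * α / (1 - α * β) * ‖F‖) ∧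
      (∀ F, P 0 * Λ F * Q 0 = Λ F) ∧ (∀ F x, Λ F x ∈ A.domain) ∧
      ∀ F x y, (x, y) ∈ A.graph → (Λ F x, Λ F y + P 0 (F (Q 0 x))) ∈ A.graph := by
  have hs := summable_sandwich (mul_nonneg hα hβ) hαβ (sandwich_bound hα hPn hQn)
  have hb' : ∀ n, ‖P (n + 1)‖ * ‖Q n‖ ≤ K ^ 2 * α * (α * β) ^ n := fun n => by
    have hK : 0 ≤ K := by simpa using (norm_nonneg _).trans (hPn 0)
    calc ‖P (n + 1)‖ * ‖Q n‖ ≤ (K * α ^ (n + 1)) * (K * β ^ n) := by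
          gcongr
          · exact hPn _
          · exact hQn _
      _ = _ := by rw [mul_pow, pow_succ]; ring
  have hs' := summable_sandwich (P := fun n => P (n + 1)) (mul_nonneg hα hβ) hαβ hb'
  -- Pulling out $P_1$ puts the values of $\Lambda F$ in $D(A)$ without applying the unbounded $A$
  -- to a series.
  have key : ∀ F, sandwichSum (fun n => P (n + 1)) Q hs' F = P 1 * ∑' n, P n * F * Q n := fun F => by
    rw [← (hs F).tsum_mul_left]
    refine tsum_congr fun n => ?_
    dsimp only
    rw [hP.succ n]
    simp only [mul_assoc]
  refine ⟨sandwichSum (fun n => P (n + 1)) Q hs',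
    fun F => norm_tsum_sandwich_le (mul_nonneg hα hβ) hαβ hb' F, fun F => ?_,
    fun F x => ?_, fun F x y hxy => ?_⟩
  · change P 0 * (∑' n, P (n + 1) * F * Q n) * Q 0 = ∑' n, P (n + 1) * F * Q n
    rw [← (hs' F).tsum_mul_left, ← ((hs' F).mul_left _).tsum_mul_right]
    refine tsum_congr fun n => ?_
    rw [← mul_assoc, ← mul_assoc, hP.zero_mul, mul_assoc, hQ.mul_zero]
  · rw [key]
    exact LinearPMap.mem_domain_iff.2 ⟨_, hP.graph ((∑' n, P n * F * Q n) x)⟩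
  · have h1 := hP.graph ((∑' n, P n * F * Q n) x)
    have h2 : P 1 ((∑' n, P n * F * Q n) x) = sandwichSum (fun n => P (n + 1)) Q hs' F x := by
      rw [key]; rfl
    have h3 : P 0 ((∑' n, P n * F * Q n) x) =
        sandwichSum (fun n => P (n + 1)) Q hs' F y + P 0 (F (Q 0 x)) := by
      have e1 : P 0 ((∑' n, P n * F * Q n) x) = (∑' n, P n * F * Q n) x := by
        change (P 0 * ∑' n, P n * F * Q n) x = _
        rw [← (hs F).tsum_mul_left]
        congr 2
        funext n
        rw [← mul_assoc, ← mul_assoc, hP.zero_mul]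
      have e2 : sandwichSum (fun n => P (n + 1)) Q hs' F y = ∑' n, P (n + 1) (F (Q (n + 1) x)) := by
        refine (tsum_sandwich_apply (hs' F) y).trans (tsum_congr fun n => ?_)
        rw [hQ.apply_eq n x y hxy]
      -- The two series differ by an index shift, so only the term $n = 0$ survives.
      rw [e1, e2, tsum_sandwich_apply (hs F), (summable_sandwich_apply (hs F) x).tsum_eq_zero_add,
        add_comm]
    rwa [h2, h3] at h1

/-- Mirror case: $\Lambda F = -\sum Q_n F P_{n+1}$, the sign being reversed because now $\Lambda F
A$, not $A \Lambda F$, starts the index at $0$. -/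
theorem exists_sylvester_forward_backward [CompleteSpace X] (hP : IsBackwardFamily A P) (hQ : IsForwardFamily A Q)
    (hα : 0 ≤ α) (hβ : 0 ≤ β) (hαβ : α * β < 1) (hPn : ∀ n, ‖P n‖ ≤ K * α ^ n)
    (hQn : ∀ n, ‖Q n‖ ≤ K * β ^ n) :
    ∃ Λ : (X →L[𝕜] X) →+ (X →L[𝕜] X), (∀ F, ‖Λ F‖ ≤ K ^ 2 * α / (1 - α * β) * ‖F‖) ∧
      (∀ F, Q 0 * Λ F * P 0 = Λ F) ∧ (∀ F x, Λ F x ∈ A.domain) ∧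
      ∀ F x y, (x, y) ∈ A.graph → (Λ F x, Λ F y + Q 0 (F (P 0 x))) ∈ A.graph := by
  have hαβ0 := mul_nonneg hα hβ
  have hs := summable_sandwich hαβ0 hαβ fun n =>
    (sandwich_bound hβ hQn hPn n).trans_eq (by rw [mul_comm β α])
  have hb' : ∀ n, ‖Q n‖ * ‖P (n + 1)‖ ≤ K ^ 2 * α * (α * β) ^ n := fun n => by
    have hK : 0 ≤ K := by simpa using (norm_nonneg _).trans (hPn 0)
    calc ‖Q n‖ * ‖P (n + 1)‖ ≤ (K * β ^ n) * (K * α ^ (n + 1)) := by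
          gcongr
          · exact hQn _
          · exact hPn _
      _ = _ := by rw [mul_pow, pow_succ]; ring
  have hs' := summable_sandwich (Q := fun n => P (n + 1)) hαβ0 hαβ hb'
  have hzero : ∀ F, Q 0 * (∑' n, Q n * F * P (n + 1)) = ∑' n, Q n * F * P (n + 1) := fun F => by
    rw [← (hs' F).tsum_mul_left]
    refine tsum_congr fun n => ?_
    rw [← mul_assoc, ← mul_assoc, hQ.zero_mul]
  refine ⟨-sandwichSum Q (fun n => P (n + 1)) hs', fun F => ?_, fun F => ?_, fun F x => ?_,
    fun F x y hxy => ?_⟩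
  · rw [AddMonoidHom.neg_apply, norm_neg]
    exact norm_tsum_sandwich_le hαβ0 hαβ hb' F
  · rw [AddMonoidHom.neg_apply, mul_neg, neg_mul, neg_inj]
    change Q 0 * (∑' n, Q n * F * P (n + 1)) * P 0 = ∑' n, Q n * F * P (n + 1)
    rw [hzero, ← (hs' F).tsum_mul_right]
    refine tsum_congr fun n => ?_
    rw [mul_assoc, hP.mul_zero]
  · refine neg_mem (S := Submodule 𝕜 X) ?_
    change (∑' n, Q n * F * P (n + 1)) x ∈ A.domain
    rw [← hzero]
    exact LinearPMap.mem_domain_iff.2 ⟨_, hQ.graph ((∑' n, Q n * F * P (n + 1)) x)⟩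
  · have h1 := hQ.graph (-((∑' n, Q n * F * P (n + 1)) x))
    rw [map_neg, map_neg] at h1
    have h2 : -Q 0 ((∑' n, Q n * F * P (n + 1)) x) =
        (-sandwichSum Q (fun n => P (n + 1)) hs') F x := by
      rw [AddMonoidHom.neg_apply]
      change -(Q 0 * _) x = -(_ : X)
      rw [hzero]; rfl
    have h3 : -Q 1 ((∑' n, Q n * F * P (n + 1)) x) =
        (-sandwichSum Q (fun n => P (n + 1)) hs') F y + Q 0 (F (P 0 x)) := by
      have e1 : Q 1 ((∑' n, Q n * F * P (n + 1)) x) = ∑' n, Q (n + 1) (F (P (n + 1) x)) := by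
        rw [tsum_sandwich_apply (hs' F), (Q 1).map_tsum
          (summable_sandwich_apply (Q := fun n => P (n + 1)) (hs' F) x)]
        refine tsum_congr fun n => ?_
        rw [hQ.succ n]; rfl
      have e2 : sandwichSum Q (fun n => P (n + 1)) hs' F y = ∑' n, Q n (F (P n x)) := by
        refine (tsum_sandwich_apply (hs' F) y).trans (tsum_congr fun n => ?_)
        rw [hP.apply_eq n x y hxy]
      rw [AddMonoidHom.neg_apply]
      change _ = -(sandwichSum Q (fun n => P (n + 1)) hs' F y) + _
      rw [e1, e2, (summable_sandwich_apply (hs F) x).tsum_eq_zero_add]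
      abel
    rwa [h2, h3] at h1

end Bounds

namespace BlockForm

variable (b : BlockForm A)

theorem commute_pow_proj {L p : X →L[𝕜] X} (h1 : p * L = L) (h2 : L * p = L) (n : ℕ) :
    p * L ^ n = L ^ n * p :=
  (show Commute p L from h1.trans h2.symm).pow_right n

theorem pow_succ_mul_proj {L p : X →L[𝕜] X} (h2 : L * p = L) (n : ℕ) :
    L ^ (n + 1) * p = L ^ (n + 1) := by rw [pow_succ, mul_assoc, h2]

theorem powFamily_identities {L p : X →L[𝕜] X} (hp : p * p = p) (h1 : p * L = L)
    (h2 : L * p = L) :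
    (∀ n, L ^ (n + 1) * p = L ^ 1 * p * (L ^ n * p)) ∧
    (∀ n, L ^ 0 * p * (L ^ n * p) = L ^ n * p) ∧ (∀ n, L ^ n * p * (L ^ 0 * p) = L ^ n * p) := by
  refine ⟨fun n => ?_, fun n => ?_, fun n => ?_⟩
  · rw [pow_one, h2, pow_succ', mul_assoc]
  · rw [pow_zero, one_mul, ← mul_assoc, commute_pow_proj h1 h2, mul_assoc, hp]
  · rw [pow_zero, one_mul, mul_assoc, hp]

theorem isForwardFamily_stab : IsForwardFamily A fun n => b.stab ^ n * b.proj .s := by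
  obtain ⟨h1, h2, h3⟩ := powFamily_identities (b.proj_idem .s) b.proj_stab b.stab_proj
  refine ⟨h1, h2, h3, fun x => ?_, fun n x y h => ?_⟩
  · simp only [pow_zero, one_mul, pow_one, b.stab_proj]
    exact b.stab_graph x
  · change (b.stab ^ n) (b.proj .s y) = _
    rw [((b.mem_graph x y).1 h).1, pow_succ_mul_proj b.stab_proj, pow_succ]; rfl

theorem isForwardFamily_cent : IsForwardFamily A fun n => b.cent ^ n * b.proj .c := by
  obtain ⟨h1, h2, h3⟩ := powFamily_identities (b.proj_idem .c) b.proj_cent b.cent_proj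
  refine ⟨h1, h2, h3, fun x => ?_, fun n x y h => ?_⟩
  · simp only [pow_zero, one_mul, pow_one, b.cent_proj]
    exact b.cent_graph x
  · change (b.cent ^ n) (b.proj .c y) = _
    rw [((b.mem_graph x y).1 h).2.1, pow_succ_mul_proj b.cent_proj, pow_succ]; rfl

theorem isBackwardFamily_unstInv : IsBackwardFamily A fun n => b.unstInv ^ n * b.proj .u := by
  obtain ⟨h1, h2, h3⟩ := powFamily_identities (b.proj_idem .u) b.proj_unstInv b.unstInv_proj
  refine ⟨h1, h2, h3, fun x => ?_, fun n x y h => ?_⟩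
  · simp only [pow_zero, one_mul, pow_one, b.unstInv_proj]
    exact b.unstInv_graph x
  · change _ = (b.unstInv ^ n) (b.proj .u x)
    rw [((b.mem_graph x y).1 h).2.2, pow_succ_mul_proj b.unstInv_proj, pow_succ]; rfl

/-- The central block is both forward and backward: it is run backward against the stable block and
forward against the unstable one. -/
theorem isBackwardFamily_centInv : IsBackwardFamily A fun n => b.centInv ^ n * b.proj .c := by
  obtain ⟨h1, h2, h3⟩ := powFamily_identities (b.proj_idem .c) b.proj_centInv b.centInv_proj
  refine ⟨h1, h2, h3, fun x => ?_, fun n x y h => ?_⟩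
  · simp only [pow_zero, one_mul, pow_one, b.centInv_proj]
    have h := b.cent_graph (b.centInv x)
    have e1 : b.proj .c (b.centInv x) = b.centInv x := DFunLike.congr_fun b.proj_centInv x
    have e2 : b.cent (b.centInv x) = b.proj .c x := DFunLike.congr_fun b.cent_mul_centInv x
    rwa [e1, e2] at h
  · have e : b.centInv y = b.proj .c x := by
      calc b.centInv y = b.centInv (b.proj .c y) := (DFunLike.congr_fun b.centInv_proj y).symm
        _ = b.centInv (b.cent x) := by rw [((b.mem_graph x y).1 h).2.1]
        _ = b.proj .c x := DFunLike.congr_fun b.centInv_mul_cent x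
    change _ = (b.centInv ^ n) (b.proj .c x)
    rw [← e, pow_succ_mul_proj b.centInv_proj, pow_succ]; rfl

/-- Geometric bounds on the powers of the blocks; `r` bounds the stable and the inverse unstable
block, `a` bounds the central block and its inverse. -/
structure HasRates (K r a : ℝ) : Prop where
  stab_le : ∀ n : ℕ, ‖b.stab ^ n * b.proj .s‖ ≤ K * r ^ n
  unst_le : ∀ n : ℕ, ‖b.unstInv ^ n * b.proj .u‖ ≤ K * r ^ n
  cent_le : ∀ n : ℕ, ‖b.cent ^ n * b.proj .c‖ ≤ K * a ^ n
  centInv_le : ∀ n : ℕ, ‖b.centInv ^ n * b.proj .c‖ ≤ K * a ^ n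

/-- The block diagonal part of a bounded operator. -/
def diag : (X →L[𝕜] X) →+ (X →L[𝕜] X) where
  toFun F := b.proj .s * F * b.proj .s + b.proj .c * F * b.proj .c + b.proj .u * F * b.proj .u
  map_zero' := by simp
  map_add' F G := by noncomm_ring

theorem diag_apply (F : X →L[𝕜] X) : b.diag F =
    b.proj .s * F * b.proj .s + b.proj .c * F * b.proj .c + b.proj .u * F * b.proj .u := rfl

theorem proj_mul_diag (k : TriLabel) (F : X →L[𝕜] X) :
    b.proj k * b.diag F = b.proj k * F * b.proj k := by
  rw [diag_apply]
  cases k <;>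
  · simp only [mul_add, ← mul_assoc, b.proj_idem]
    repeat rw [b.proj_mul_of_ne _ _ (by simp)]
    simp

theorem diag_mul_proj (k : TriLabel) (F : X →L[𝕜] X) :
    b.diag F * b.proj k = b.proj k * F * b.proj k := by
  rw [diag_apply]
  cases k <;>
  · simp only [add_mul, mul_assoc, b.proj_idem]
    repeat rw [b.proj_mul_of_ne _ _ (by simp)]
    simp

theorem diag_eq_zero {F : X →L[𝕜] X} (h : ∀ k, b.proj k * F * b.proj k = 0) : b.diag F = 0 := by
  rw [diag_apply, h, h, h, add_zero, add_zero]

/-- The six off-diagonal blocks, in the order of the six solution operators summed in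
`exists_sylvester`. -/
theorem sub_diag_apply (F : X →L[𝕜] X) (x : X) : (F - b.diag F) x =
    b.proj .c (F (b.proj .s x)) + b.proj .s (F (b.proj .c x)) +
    (b.proj .u (F (b.proj .s x)) + b.proj .s (F (b.proj .u x))) +
    (b.proj .u (F (b.proj .c x)) + b.proj .c (F (b.proj .u x))) := by
  have h : F = (b.proj .s + b.proj .c + b.proj .u) * F * (b.proj .s + b.proj .c + b.proj .u) := by
    rw [b.sum_proj, one_mul, mul_one]
  have h2 : F - b.diag F = b.proj .c * F * b.proj .s + b.proj .s * F * b.proj .c +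
      (b.proj .u * F * b.proj .s + b.proj .s * F * b.proj .u) +
      (b.proj .u * F * b.proj .c + b.proj .c * F * b.proj .u) := by
    rw [diag_apply]
    nth_rewrite 1 [h]
    noncomm_ring
  rw [h2]
  rfl

theorem proj_mul_mul_proj_eq_zero {i j k : TriLabel} (hij : i ≠ j) {p q F : X →L[𝕜] X}
    (hp : p = b.proj i) (hq : q = b.proj j) (h : p * F * q = F) :
    b.proj k * F * b.proj k = 0 := by
  subst hp hq
  rw [← h]
  by_cases hk : k = i
  · have h0 := b.proj_mul_of_ne j k (by rintro rfl; exact hij hk.symm)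
    rw [mul_assoc (b.proj k), mul_assoc (b.proj i * F), h0, mul_zero, mul_zero]
  · rw [← mul_assoc, ← mul_assoc, b.proj_mul_of_ne k i hk, zero_mul, zero_mul, zero_mul]

/-- The products of rates that occur are $ar$ and $r^2 \le ar$, all below $1$; each of the six
series has norm at most $K^2a/(1-ar)$. -/
theorem exists_sylvester [CompleteSpace X] {K r a : ℝ} (hb : b.HasRates K r a) (hr : 0 ≤ r) (ha : 1 ≤ a)
    (hra : r ≤ a) (hlt : a * r < 1) :
    ∃ Λ : (X →L[𝕜] X) →+ (X →L[𝕜] X), (∀ F, ‖Λ F‖ ≤ 6 * (K ^ 2 * a / (1 - a * r)) * ‖F‖) ∧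
      (∀ F k, b.proj k * Λ F * b.proj k = 0) ∧ (∀ F x, Λ F x ∈ A.domain) ∧
      ∀ F x y, (x, y) ∈ A.graph → (Λ F x, Λ F y + (F - b.diag F) x) ∈ A.graph := by
  have ha0 : 0 ≤ a := zero_le_one.trans ha
  have hlt' : r * a < 1 := by rwa [mul_comm]
  have hrr : r * r < 1 := lt_of_le_of_lt (by gcongr) hlt
  obtain ⟨Λ₁, l₁, o₁, d₁, g₁⟩ := exists_sylvester_backward_forward b.isBackwardFamily_centInv
    b.isForwardFamily_stab ha0 hr hlt hb.centInv_le hb.stab_le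
  obtain ⟨Λ₂, l₂, o₂, d₂, g₂⟩ := exists_sylvester_forward_backward b.isBackwardFamily_centInv
    b.isForwardFamily_stab ha0 hr hlt hb.centInv_le hb.stab_le
  obtain ⟨Λ₃, l₃, o₃, d₃, g₃⟩ := exists_sylvester_backward_forward b.isBackwardFamily_unstInv
    b.isForwardFamily_stab hr hr hrr hb.unst_le hb.stab_le
  obtain ⟨Λ₄, l₄, o₄, d₄, g₄⟩ := exists_sylvester_forward_backward b.isBackwardFamily_unstInv
    b.isForwardFamily_stab hr hr hrr hb.unst_le hb.stab_le
  obtain ⟨Λ₅, l₅, o₅, d₅, g₅⟩ := exists_sylvester_backward_forward b.isBackwardFamily_unstInv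
    b.isForwardFamily_cent hr ha0 hlt' hb.unst_le hb.cent_le
  obtain ⟨Λ₆, l₆, o₆, d₆, g₆⟩ := exists_sylvester_forward_backward b.isBackwardFamily_unstInv
    b.isForwardFamily_cent hr ha0 hlt' hb.unst_le hb.cent_le
  simp only [pow_zero, one_mul] at o₁ o₂ o₃ o₄ o₅ o₆ g₁ g₂ g₃ g₄ g₅ g₆
  have c₁ : K ^ 2 * r / (1 - r * r) ≤ K ^ 2 * a / (1 - a * r) := by
    have : 0 < 1 - a * r := by linarith
    gcongr
  have c₂ : K ^ 2 * r / (1 - r * a) ≤ K ^ 2 * a / (1 - a * r) := by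
    rw [mul_comm r a]
    have : 0 < 1 - a * r := by linarith
    gcongr
  refine ⟨Λ₁ + Λ₂ + (Λ₃ + Λ₄) + (Λ₅ + Λ₆), fun F => ?_, fun F k => ?_,
    fun F x => add_mem (add_mem (add_mem (d₁ F x) (d₂ F x)) (add_mem (d₃ F x) (d₄ F x)))
      (add_mem (d₅ F x) (d₆ F x)), fun F x y h => ?_⟩
  · set M := K ^ 2 * a / (1 - a * r)
    have m₃ := (l₃ F).trans (mul_le_mul_of_nonneg_right c₁ (norm_nonneg F))
    have m₄ := (l₄ F).trans (mul_le_mul_of_nonneg_right c₁ (norm_nonneg F))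
    have m₅ := (l₅ F).trans (mul_le_mul_of_nonneg_right c₂ (norm_nonneg F))
    have m₆ := (l₆ F).trans (mul_le_mul_of_nonneg_right c₂ (norm_nonneg F))
    change ‖Λ₁ F + Λ₂ F + (Λ₃ F + Λ₄ F) + (Λ₅ F + Λ₆ F)‖ ≤ _
    have n₁ := norm_add_le (Λ₁ F + Λ₂ F + (Λ₃ F + Λ₄ F)) (Λ₅ F + Λ₆ F)
    have n₂ := norm_add_le (Λ₁ F + Λ₂ F) (Λ₃ F + Λ₄ F)
    have n₃ := norm_add_le (Λ₁ F) (Λ₂ F)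
    have n₄ := norm_add_le (Λ₃ F) (Λ₄ F)
    have n₅ := norm_add_le (Λ₅ F) (Λ₆ F)
    linarith [l₁ F, l₂ F]
  · change b.proj k * (Λ₁ F + Λ₂ F + (Λ₃ F + Λ₄ F) + (Λ₅ F + Λ₆ F)) * b.proj k = 0
    simp only [mul_add, add_mul]
    rw [b.proj_mul_mul_proj_eq_zero (by simp) rfl rfl (o₁ F),
      b.proj_mul_mul_proj_eq_zero (by simp) rfl rfl (o₂ F),
      b.proj_mul_mul_proj_eq_zero (by simp) rfl rfl (o₃ F),
      b.proj_mul_mul_proj_eq_zero (by simp) rfl rfl (o₄ F),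
      b.proj_mul_mul_proj_eq_zero (by simp) rfl rfl (o₅ F),
      b.proj_mul_mul_proj_eq_zero (by simp) rfl rfl (o₆ F)]
    simp
  · have hsum := add_mem (add_mem (add_mem (g₁ F x y h) (g₂ F x y h))
      (add_mem (g₃ F x y h) (g₄ F x y h))) (add_mem (g₅ F x y h) (g₆ F x y h))
    simp only [Prod.mk_add_mk] at hsum
    rw [sub_diag_apply]
    convert hsum using 2
    · rfl
    change Λ₁ F y + Λ₂ F y + (Λ₃ F y + Λ₄ F y) + (Λ₅ F y + Λ₆ F y) + _ = _
    abel

end BlockForm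

end Sylvester


/-! ### Block diagonal perturbations, similarity, and the resulting estimates. -/

section Perturbation

theorem norm_conj_pow_sub_le {R : Type*} [NormedRing R] {T E p H Wi : R} {K r r' e h : ℝ}
    (hK : 0 ≤ K) (hr : 0 ≤ r) (he : 0 ≤ e) (hrr' : r < r') (hKe : K * e ≤ r' - r)
    (hT : ∀ n : ℕ, ‖T ^ n * p‖ ≤ K * r ^ n) (hpE : p * E = E) (hE : ‖E‖ ≤ e)
    (hWi : (1 + H) * Wi = 1) (hH : ‖H‖ ≤ h) (hWin : ‖Wi‖ ≤ 3 / 2) (n : ℕ) :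
    ‖(1 + H) * ((T + E) ^ n * p) * Wi - T ^ n * p‖ ≤
      (6 * h * K + K * (K * e / (r' - r))) * r' ^ n := by
  have hg : 0 < r' - r := sub_pos.2 hrr'
  have h0 : 0 ≤ h := (norm_nonneg _).trans hH
  have h1 := norm_pow_add_mul_sub_le_of_lt hK hr he hrr' hKe hT hpE hE n
  have hη : K * e / (r' - r) ≤ 1 := (div_le_one hg).2 hKe
  have hr'n : 0 ≤ r' ^ n := pow_nonneg (hr.trans hrr'.le) n
  -- The factor $2$ here times the $3h$ of `norm_mul_mul_inv_sub_le` gives the coefficient $6hK$.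
  have h2 : ‖(T + E) ^ n * p‖ ≤ 2 * K * r' ^ n := by
    have e1 := norm_add_le ((T + E) ^ n * p - T ^ n * p) (T ^ n * p)
    rw [sub_add_cancel] at e1
    have e2 : K * r ^ n ≤ K * r' ^ n := by gcongr
    have e3 : K * (K * e / (r' - r)) * r' ^ n ≤ K * 1 * r' ^ n := by gcongr
    linarith [hT n]
  have h3 := norm_mul_mul_inv_sub_le (Y := (T + E) ^ n * p) hWi hH hWin
  have h4 : 3 * h * ‖(T + E) ^ n * p‖ ≤ 3 * h * (2 * K * r' ^ n) := by gcongr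
  have h5 := norm_add_le ((1 + H) * ((T + E) ^ n * p) * Wi - (T + E) ^ n * p)
    ((T + E) ^ n * p - T ^ n * p)
  rw [sub_add_sub_cancel] at h5
  linarith

variable {𝕜 X : Type*} [RCLike 𝕜] [NormedAddCommGroup X] [NormedSpace 𝕜 X]

theorem mem_graph_vadd (A : X →ₗ.[𝕜] X) (D : X →L[𝕜] X) (x y : X) :
    (x, y) ∈ ((D : X →ₗ[𝕜] X) +ᵥ A).graph ↔ (x, y - D x) ∈ A.graph := by
  simp only [LinearPMap.mem_graph_iff]
  constructor
  · rintro ⟨w, rfl, rfl⟩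
    refine ⟨w, rfl, ?_⟩
    rw [LinearPMap.vadd_apply]
    exact (add_sub_cancel_left _ _).symm
  · rintro ⟨w, rfl, h⟩
    refine ⟨w, rfl, ?_⟩
    rw [LinearPMap.vadd_apply, h]
    exact add_sub_cancel _ _

theorem unit_apply_injective (W : (X →L[𝕜] X)ˣ) : Function.Injective (W : X →L[𝕜] X) := by
  intro x y h
  have h' := congrArg (↑W⁻¹ : X →L[𝕜] X) h
  have e : ∀ z, (↑W⁻¹ : X →L[𝕜] X) ((W : X →L[𝕜] X) z) = z := fun z =>
    DFunLike.congr_fun W.inv_mul z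
  rwa [e, e] at h'

theorem unit_conj_mul_conj {R : Type*} [Ring R] (W : Rˣ) (L M : R) :
    ↑W * L * ↑W⁻¹ * (↑W * M * ↑W⁻¹) = ↑W * (L * M) * ↑W⁻¹ := by
  simp only [mul_assoc, Units.inv_mul_cancel_left]

namespace BlockForm

variable {A : X →ₗ.[𝕜] X} (b : BlockForm A)

/-- Transport of a block form by a similarity. -/
def conj (W : (X →L[𝕜] X)ˣ) (A' : X →ₗ.[𝕜] X) (h : ∀ x y, ((W : X →L[𝕜] X) x,
    (W : X →L[𝕜] X) y) ∈ A'.graph ↔ (x, y) ∈ A.graph) : BlockForm A' where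
  proj k := W * b.proj k * ↑W⁻¹
  proj_idem k := by rw [unit_conj_mul_conj, b.proj_idem]
  proj_mul_of_ne j k hjk := by rw [unit_conj_mul_conj, b.proj_mul_of_ne j k hjk]; simp
  sum_proj := by rw [← add_mul, ← add_mul, ← mul_add, ← mul_add, b.sum_proj]; simp
  stab := W * b.stab * ↑W⁻¹
  cent := W * b.cent * ↑W⁻¹
  centInv := W * b.centInv * ↑W⁻¹
  unstInv := W * b.unstInv * ↑W⁻¹
  proj_stab := by rw [unit_conj_mul_conj, b.proj_stab]
  stab_proj := by rw [unit_conj_mul_conj, b.stab_proj]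
  proj_cent := by rw [unit_conj_mul_conj, b.proj_cent]
  cent_proj := by rw [unit_conj_mul_conj, b.cent_proj]
  proj_centInv := by rw [unit_conj_mul_conj, b.proj_centInv]
  centInv_proj := by rw [unit_conj_mul_conj, b.centInv_proj]
  proj_unstInv := by rw [unit_conj_mul_conj, b.proj_unstInv]
  unstInv_proj := by rw [unit_conj_mul_conj, b.unstInv_proj]
  cent_mul_centInv := by rw [unit_conj_mul_conj, b.cent_mul_centInv]
  centInv_mul_cent := by rw [unit_conj_mul_conj, b.centInv_mul_cent]
  mem_graph x y := by
    have e : ∀ z, (W : X →L[𝕜] X) ((↑W⁻¹ : X →L[𝕜] X) z) = z := fun z =>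
      DFunLike.congr_fun W.mul_inv z
    have h' := h ((↑W⁻¹ : X →L[𝕜] X) x) ((↑W⁻¹ : X →L[𝕜] X) y)
    rw [e, e] at h'
    rw [h', b.mem_graph]
    exact and_congr (unit_apply_injective W).eq_iff.symm
      (and_congr (unit_apply_injective W).eq_iff.symm (unit_apply_injective W).eq_iff.symm)

/-- Perturbation of a block form by a block diagonal operator. -/
def addDiag (D : X →L[𝕜] X) (hD : ∀ k, b.proj k * D = D * b.proj k) (zc zu : (X →L[𝕜] X)ˣ)
    (hzc : (zc : X →L[𝕜] X) = 1 + D * b.centInv) (hzu : (zu : X →L[𝕜] X) = 1 + D * b.unstInv) :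
    BlockForm ((D : X →ₗ[𝕜] X) +ᵥ A) :=
  have hc : Commute (b.proj .c) (zc : X →L[𝕜] X) := by
    rw [hzc]
    refine (Commute.one_right _).add_right ?_
    change _ = _
    rw [← mul_assoc, hD, mul_assoc, b.proj_centInv, mul_assoc, b.centInv_proj]
  have hu : Commute (b.proj .u) (zu : X →L[𝕜] X) := by
    rw [hzu]
    refine (Commute.one_right _).add_right ?_
    change _ = _
    rw [← mul_assoc, hD, mul_assoc, b.proj_unstInv, mul_assoc, b.unstInv_proj]
  { proj := b.proj
    proj_idem := b.proj_idem
    proj_mul_of_ne := b.proj_mul_of_ne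
    sum_proj := b.sum_proj
    stab := b.stab + D * b.proj .s
    cent := b.cent + D * b.proj .c
    centInv := b.centInv * ↑zc⁻¹
    unstInv := b.unstInv * ↑zu⁻¹
    proj_stab := by rw [mul_add, b.proj_stab, ← mul_assoc, hD, mul_assoc, b.proj_idem]
    stab_proj := by rw [add_mul, b.stab_proj, mul_assoc, b.proj_idem]
    proj_cent := by rw [mul_add, b.proj_cent, ← mul_assoc, hD, mul_assoc, b.proj_idem]
    cent_proj := by rw [add_mul, b.cent_proj, mul_assoc, b.proj_idem]
    proj_centInv := by rw [← mul_assoc, b.proj_centInv]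
    centInv_proj := by rw [mul_assoc, ← hc.units_inv_right.eq, ← mul_assoc, b.centInv_proj]
    proj_unstInv := by rw [← mul_assoc, b.proj_unstInv]
    unstInv_proj := by rw [mul_assoc, ← hu.units_inv_right.eq, ← mul_assoc, b.unstInv_proj]
    cent_mul_centInv := by
      rw [← mul_assoc, add_mul, b.cent_mul_centInv, mul_assoc D, b.proj_centInv]
      have : b.proj .c + D * b.centInv = b.proj .c * zc := by
        rw [hzc, mul_add, mul_one, ← mul_assoc, hD, mul_assoc, b.proj_centInv]
      rw [this, Units.mul_inv_cancel_right]
    centInv_mul_cent := by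
      have : b.cent + D * b.proj .c = zc * b.cent := by
        rw [hzc, add_mul, one_mul, mul_assoc, b.centInv_mul_cent]
      rw [this, mul_assoc, Units.inv_mul_cancel_left, b.centInv_mul_cent]
    mem_graph := fun x z => by
      have hDp : ∀ k y, b.proj k (D y) = D (b.proj k y) := fun k y => DFunLike.congr_fun (hD k) y
      rw [mem_graph_vadd, b.mem_graph, map_sub, map_sub, hDp, hDp, sub_eq_iff_eq_add,
        sub_eq_iff_eq_add]
      refine and_congr Iff.rfl (and_congr Iff.rfl ?_)
      have hVD : b.unstInv (D x) = b.unstInv (D (b.proj .u x)) := by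
        rw [← b.unstInv_apply (D x), hDp]
      rw [map_sub, hVD, ← map_sub]
      change _ ↔ b.proj .u x = b.unstInv ((↑zu⁻¹ : X →L[𝕜] X) z)
      have ez : ∀ w, (zu : X →L[𝕜] X) w = w + D (b.unstInv w) := fun w => by rw [hzu]; rfl
      have ei : (zu : X →L[𝕜] X) ((↑zu⁻¹ : X →L[𝕜] X) z) = z := DFunLike.congr_fun zu.mul_inv z
      -- With $V = A_u^{-1}\Pi_u$ and $w = z - D\Pi_u x$, the relation $\Pi_u x = Vw$ says $z = w +
      -- DVw$, that is, $w = (1+DV)^{-1}z$.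
      constructor
      · intro h
        have hw : (↑zu⁻¹ : X →L[𝕜] X) z = z - D (b.proj .u x) := by
          apply unit_apply_injective zu
          rw [ei, ez, ← h]
          abel
        rw [hw]
        exact h
      · intro h
        have h2 := ez ((↑zu⁻¹ : X →L[𝕜] X) z)
        rw [ei, ← h] at h2
        rw [h2, add_sub_cancel_right]
        exact h }

theorem norm_proj_le {K r a : ℝ} (hb : b.HasRates K r a) (k : TriLabel) : ‖b.proj k‖ ≤ K := by
  cases k
  · simpa using hb.stab_le 0
  · simpa using hb.cent_le 0
  · simpa using hb.unst_le 0

theorem norm_diag_le {K r a : ℝ} (hb : b.HasRates K r a) (F : X →L[𝕜] X) :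
    ‖b.diag F‖ ≤ 3 * K ^ 2 * ‖F‖ := by
  have h : ∀ k, ‖b.proj k * F * b.proj k‖ ≤ K ^ 2 * ‖F‖ := fun k => by
    have hk := b.norm_proj_le hb k
    have hK : 0 ≤ K := (norm_nonneg _).trans hk
    calc ‖b.proj k * F * b.proj k‖ ≤ ‖b.proj k‖ * ‖F‖ * ‖b.proj k‖ :=
          (norm_mul_le _ _).trans (by gcongr; exact norm_mul_le _ _)
      _ ≤ K * ‖F‖ * K := by gcongr
      _ = _ := by ring
  rw [diag_apply]
  have h1 := norm_add_le (b.proj .s * F * b.proj .s + b.proj .c * F * b.proj .c)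
    (b.proj .u * F * b.proj .u)
  have h2 := norm_add_le (b.proj .s * F * b.proj .s) (b.proj .c * F * b.proj .c)
  linarith [h .s, h .c, h .u]

theorem proj_commute_diag (k : TriLabel) (F : X →L[𝕜] X) :
    b.proj k * b.diag F = b.diag F * b.proj k := by rw [proj_mul_diag, diag_mul_proj]

/-- The intertwining relation $(A+B)W = W(A+D)$, domains included. -/
theorem conj_mem_graph_iff {Λ : (X →L[𝕜] X) →+ (X →L[𝕜] X)} {B H : X →L[𝕜] X}
    (hΛo : ∀ F k, b.proj k * Λ F * b.proj k = 0) (hΛd : ∀ F x, Λ F x ∈ A.domain)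
    (hΛg : ∀ F x y, (x, y) ∈ A.graph → (Λ F x, Λ F y + (F - b.diag F) x) ∈ A.graph)
    (hH : Λ (H * b.diag (B + B * H) - B - B * H) = H) (W : (X →L[𝕜] X)ˣ)
    (hW : (W : X →L[𝕜] X) = 1 + H) (x y : X) :
    ((W : X →L[𝕜] X) x, (W : X →L[𝕜] X) y) ∈ ((B : X →ₗ[𝕜] X) +ᵥ A).graph ↔
      (x, y) ∈ (((b.diag (B + B * H) : X →L[𝕜] X) : X →ₗ[𝕜] X) +ᵥ A).graph := by
  set D := b.diag (B + B * H) with hDdef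
  -- An off-diagonal operator times a block diagonal one is off-diagonal.
  have hd0 : b.diag (H * D) = 0 := b.diag_eq_zero fun k => by
    rw [mul_assoc, mul_assoc, hDdef, ← b.proj_commute_diag, ← mul_assoc, ← mul_assoc, ← hH, hΛo,
      zero_mul]
  have hoff : H * D - B - B * H - b.diag (H * D - B - B * H) = H * D - B - B * H + D := by
    rw [sub_sub (H * D), map_sub, hd0, ← hDdef]
    abel
  have hWx : ∀ x, (W : X →L[𝕜] X) x = x + H x := fun x => by rw [hW]; rfl
  rw [mem_graph_vadd, mem_graph_vadd]
  have key : ∀ x y, (x, y) ∈ A.graph →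
      ((W : X →L[𝕜] X) x, (W : X →L[𝕜] X) (y + D x) - B ((W : X →L[𝕜] X) x)) ∈ A.graph := by
    intro x y h
    have h1 := add_mem h (hΛg (H * D - B - B * H) x y h)
    rw [hoff, hH, Prod.mk_add_mk] at h1
    have e : y + (H y + (H * D - B - B * H + D) x) =
        (W : X →L[𝕜] X) (y + D x) - B ((W : X →L[𝕜] X) x) := by
      rw [hWx, hWx]
      change y + (H y + (H (D x) - B x - B (H x) + D x)) = _
      simp only [map_add]
      abel
    rwa [e, ← hWx] at h1
  constructor
  · intro h
    -- $H$ takes values in $D(A)$, so $x = Wx - Hx$ inherits membership from $Wx$.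
    have hx : x ∈ A.domain := by
      have h1 : (W : X →L[𝕜] X) x ∈ A.domain := LinearPMap.mem_domain_iff.2 ⟨_, h⟩
      have h2 : H x ∈ A.domain := by rw [← hH]; exact hΛd _ x
      have h3 : x = (W : X →L[𝕜] X) x - H x := by rw [hWx, add_sub_cancel_right]
      rw [h3]
      exact sub_mem h1 h2
    obtain ⟨y0, hy0⟩ := LinearPMap.mem_domain_iff.1 hx
    have h1 := A.mem_graph_snd_inj h (key x y0 hy0) rfl
    have h2 : y = y0 + D x := unit_apply_injective W (sub_left_injective h1)
    rwa [h2, add_sub_cancel_right]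
  · intro h
    have h1 := key x _ h
    rwa [sub_add_cancel] at h1

/-- The constant controlling the similarity that block diagonalizes the perturbed operator. -/
noncomputable def simConst (K r a : ℝ) : ℝ :=
  2 * (6 * (K ^ 2 * a / (1 - a * r))) * (3 * K ^ 2 + 1)

theorem simConst_nonneg {K r a : ℝ} (ha : 1 ≤ a) (hlt : a * r < 1) : 0 ≤ simConst K r a := by
  have : 0 < 1 - a * r := by linarith
  unfold simConst
  positivity

/-- `b'` is within `ε` of `b`, with rates `r'` and `a'`, and the projectors are similar. -/
structure IsNear {A' : X →ₗ.[𝕜] X} (b' : BlockForm A') (b : BlockForm A) (ε r' a' : ℝ) : Prop where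
  similar : ∃ W : (X →L[𝕜] X)ˣ, ∀ k, b'.proj k = W * b.proj k * ↑W⁻¹
  proj_le : ∀ k, ‖b'.proj k - b.proj k‖ ≤ ε
  stab_le : ∀ n : ℕ, ‖b'.stab ^ n * b'.proj .s - b.stab ^ n * b.proj .s‖ ≤ ε * r' ^ n
  unst_le : ∀ n : ℕ, ‖b'.unstInv ^ n * b'.proj .u - b.unstInv ^ n * b.proj .u‖ ≤ ε * r' ^ n
  cent_le : ∀ n : ℕ, ‖b'.cent ^ n * b'.proj .c - b.cent ^ n * b.proj .c‖ ≤ ε * a' ^ n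
  centInv_le : ∀ n : ℕ, ‖b'.centInv ^ n * b'.proj .c - b.centInv ^ n * b.proj .c‖ ≤ ε * a' ^ n

theorem norm_mul_unit_inv_sub_le {R : Type*} [NormedRing R] {D V : R} {z : Rˣ} {c d w : ℝ}
    (hz : (z : R) = 1 + D * V) (hzi : ‖(↑z⁻¹ : R)‖ ≤ c) (hD : ‖D‖ ≤ d) (hV : ‖V‖ ≤ w) :
    ‖V * ↑z⁻¹ - V‖ ≤ w * (d * w) * c := by
  have hw : 0 ≤ w := (norm_nonneg _).trans hV
  have hd : 0 ≤ d := (norm_nonneg _).trans hD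
  -- The second resolvent identity.
  have e : V * ↑z⁻¹ - V = -(V * (D * V) * ↑z⁻¹) := by
    have h1 : (1 : R) = (1 + D * V) * ↑z⁻¹ := by rw [← hz, Units.mul_inv]
    calc V * ↑z⁻¹ - V = V * ↑z⁻¹ - V * ((1 + D * V) * ↑z⁻¹) := by rw [← h1, mul_one]
      _ = _ := by noncomm_ring
  rw [e, norm_neg]
  calc ‖V * (D * V) * ↑z⁻¹‖ ≤ ‖V‖ * (‖D‖ * ‖V‖) * ‖(↑z⁻¹ : R)‖ := by
        refine (norm_mul_le _ _).trans ?_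
        gcongr
        refine (norm_mul_le _ _).trans ?_
        gcongr
        exact norm_mul_le _ _
    _ ≤ _ := by gcongr

theorem exists_isNear [CompleteSpace X] {K r r' a a' g β : ℝ} (hb : b.HasRates K r a)
    (hK : 1 ≤ K) (hr : 0 ≤ r) (ha : 1 ≤ a) (hra : r ≤ a) (hlt : a * r < 1) (hg : 0 < g)
    (hrg : g ≤ r' - r) (hag : g ≤ a' - a) {B : X →L[𝕜] X} (hB : ‖B‖ ≤ β)
    (h1 : 3 * simConst K r a * β ≤ 1) (h2 : 12 * K ^ 4 * a ^ 2 * β ≤ 1)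
    (h3 : K * (12 * K ^ 4 * a ^ 2 * β) ≤ g) :
    ∃ b' : BlockForm ((B : X →ₗ[𝕜] X) +ᵥ A), b'.IsNear b
      (6 * (simConst K r a * β) * K + K * (K * (12 * K ^ 4 * a ^ 2 * β) / g)) r' a' := by
  have hβ : 0 ≤ β := (norm_nonneg _).trans hB
  have ha0 : 0 ≤ a := by linarith
  have hK0 : 0 ≤ K := by linarith
  have hs0 := simConst_nonneg (K := K) ha hlt
  have hone : ‖(1 : X →L[𝕜] X)‖ ≤ 1 := ContinuousLinearMap.norm_id_le
  obtain ⟨Λ, hΛ, hΛo, hΛd, hΛg⟩ := b.exists_sylvester hb hr ha hra hlt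
  have hL : 0 ≤ 6 * (K ^ 2 * a / (1 - a * r)) := by
    have : 0 < 1 - a * r := by linarith
    positivity
  obtain ⟨H, hHn, hHΛ⟩ := exists_fixedPoint_quadratic Λ b.diag hL (by positivity) hΛ
    (b.norm_diag_le hb) hB h1
  change ‖H‖ ≤ simConst K r a * β at hHn
  set h := simConst K r a * β with hh
  have h0 : 0 ≤ h := by positivity
  have h13 : h ≤ 1 / 3 := by linarith
  obtain ⟨W, hW, hWn⟩ := exists_unit_one_add hone hHn (by linarith)
  have hWn' : ‖(↑W⁻¹ : X →L[𝕜] X)‖ ≤ 3 / 2 := hWn.trans (by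
    rw [div_le_iff₀ (by linarith)]; linarith)
  have hWi : (1 + H) * ↑W⁻¹ = 1 := by rw [← hW, Units.mul_inv]
  have hgr := b.conj_mem_graph_iff hΛo hΛd hΛg hHΛ W hW
  set D := b.diag (B + B * H) with hD
  have hDn : ‖D‖ ≤ 6 * K ^ 2 * β := by
    have e1 : ‖B * H‖ ≤ β := (norm_mul_le _ _).trans (by
      calc ‖B‖ * ‖H‖ ≤ β * 1 := by gcongr; linarith
        _ = β := mul_one _)
    calc ‖D‖ ≤ 3 * K ^ 2 * ‖B + B * H‖ := b.norm_diag_le hb _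
      _ ≤ 3 * K ^ 2 * (β + β) := by
          gcongr
          exact (norm_add_le _ _).trans (by linarith)
      _ = _ := by ring
  have hDcomm : ∀ k, b.proj k * D = D * b.proj k := fun k => b.proj_commute_diag k _
  -- A common bound for the change in all four blocks: $(Ka)^2 \cdot 6K^2\beta \cdot 2$, from
  -- $\|V\|^2\,\|D\|\,\|(1+DV)^{-1}\|$ for the inverse blocks. It dominates $\|D\Pi_k\|$ because $Ka
  -- \ge 1$.
  set e := 12 * K ^ 4 * a ^ 2 * β with he
  have he0 : 0 ≤ e := by positivity
  have hKa : 1 ≤ K * a := one_le_mul_of_one_le_of_one_le hK ha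
  have hDp : ∀ k, ‖D * b.proj k‖ ≤ e := fun k => by
    calc ‖D * b.proj k‖ ≤ 6 * K ^ 2 * β * K := (norm_mul_le _ _).trans (by
            gcongr; exact b.norm_proj_le hb k)
      _ = 6 * K ^ 2 * β * (K * 1) := by ring
      _ ≤ 6 * K ^ 2 * β * ((K * a) * (K * a)) := by
          have : K * 1 ≤ (K * a) * (K * a) := by
            have : K ≤ K * a := by nlinarith
            nlinarith
          gcongr
      _ ≤ e := by rw [he]; nlinarith [show 0 ≤ K ^ 4 * a ^ 2 * β by positivity]
  have hcn : ‖b.centInv‖ ≤ K * a := by simpa [b.centInv_proj] using hb.centInv_le 1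
  have hun : ‖b.unstInv‖ ≤ K * a := by
    have : ‖b.unstInv‖ ≤ K * r := by simpa [b.unstInv_proj] using hb.unst_le 1
    exact this.trans (by gcongr)
  have hz : ∀ V : X →L[𝕜] X, ‖V‖ ≤ K * a → ‖D * V‖ ≤ 1 / 2 := fun V hV => by
    calc ‖D * V‖ ≤ 6 * K ^ 2 * β * (K * a) := (norm_mul_le _ _).trans (by gcongr)
      _ = 6 * K ^ 2 * β * (1 * (K * a)) := by ring
      _ ≤ 6 * K ^ 2 * β * ((K * a) * (K * a)) := by gcongr
      _ ≤ 1 / 2 := by rw [he] at h2; linarith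
  obtain ⟨zc, hzc, hzcn⟩ := exists_unit_one_add hone (hz _ hcn) le_rfl
  obtain ⟨zu, hzu, hzun⟩ := exists_unit_one_add hone (hz _ hun) le_rfl
  have hE : ∀ (V : X →L[𝕜] X) (z : (X →L[𝕜] X)ˣ), ‖V‖ ≤ K * a → (z : X →L[𝕜] X) = 1 + D * V →
      ‖(↑z⁻¹ : X →L[𝕜] X)‖ ≤ 1 / (1 - 1 / 2) → ‖V * ↑z⁻¹ - V‖ ≤ e := fun V z hV hzV hzi =>
    (norm_mul_unit_inv_sub_le hzV hzi hDn hV).trans (le_of_eq (by rw [he]; ring))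
  let bD := b.addDiag D hDcomm zc zu hzc hzu
  have hrr' : r < r' := by linarith
  have haa' : a < a' := by linarith
  have hbnd : ∀ {q q' : ℝ}, 0 ≤ q → g ≤ q' - q → ∀ (T T' p : X →L[𝕜] X),
      (∀ n : ℕ, ‖T ^ n * p‖ ≤ K * q ^ n) → p * T = T → p * T' = T' → ‖T' - T‖ ≤ e → ∀ n : ℕ,
      ‖(↑W * T' * ↑W⁻¹) ^ n * (↑W * p * ↑W⁻¹) - T ^ n * p‖ ≤
        (6 * h * K + K * (K * e / g)) * q' ^ n := by
    intro q q' hq hgq T T' p hT hpT hpT' hTT' n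
    have hq' : 0 ≤ q' := by linarith
    rw [Units.conj_pow, unit_conj_mul_conj, hW]
    have := norm_conj_pow_sub_le (E := T' - T) hK0 hq he0 (by linarith) (h3.trans hgq) hT
      (by rw [mul_sub, hpT, hpT']) hTT' hWi hHn hWn' n
    rw [add_sub_cancel] at this
    refine this.trans ?_
    gcongr
  refine ⟨bD.conj W _ hgr, ⟨⟨W, fun k => rfl⟩, fun k => ?_, ?_, ?_, ?_, ?_⟩⟩
  · have := norm_mul_mul_inv_sub_le (Y := b.proj k) hWi hHn hWn'
    rw [← hW] at this
    refine this.trans ?_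
    have e1 : 3 * h * ‖b.proj k‖ ≤ 3 * h * K := by gcongr; exact b.norm_proj_le hb k
    have e2 : 0 ≤ K * (K * e / g) := by positivity
    nlinarith [mul_nonneg h0 hK0]
  · exact hbnd hr hrg b.stab bD.stab _ hb.stab_le b.proj_stab bD.proj_stab (by
      change ‖b.stab + D * b.proj .s - b.stab‖ ≤ e
      rw [add_sub_cancel_left]; exact hDp _)
  · exact hbnd hr hrg b.unstInv bD.unstInv _ hb.unst_le b.proj_unstInv bD.proj_unstInv
      (hE _ zu hun hzu hzun)
  · exact hbnd ha0 hag b.cent bD.cent _ hb.cent_le b.proj_cent bD.proj_cent (by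
      change ‖b.cent + D * b.proj .c - b.cent‖ ≤ e
      rw [add_sub_cancel_left]; exact hDp _)
  · exact hbnd ha0 hag b.centInv bD.centInv _ hb.centInv_le b.proj_centInv bD.proj_centInv
      (hE _ zc hcn hzc hzcn)

end BlockForm

end Perturbation


/-! ### From block estimates to trichotomy estimates in either norm. -/

section Assembly

variable {𝕜 X : Type*} [RCLike 𝕜] [NormedAddCommGroup X] [NormedSpace 𝕜 X]

theorem exp_mul_natCast (x : ℝ) (n : ℕ) : Real.exp (x * n) = Real.exp x ^ n := by
  rw [mul_comm, Real.exp_nat_mul]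

theorem exp_mul_abs_natCast (x : ℝ) (n : ℕ) :
    Real.exp (x * |((n : ℤ) : ℝ)|) = Real.exp x ^ n := by
  rw [← exp_mul_natCast]; simp

theorem exp_mul_abs_neg_natCast (x : ℝ) (n : ℕ) :
    Real.exp (x * |((-n : ℤ) : ℝ)|) = Real.exp x ^ n := by
  rw [← exp_mul_natCast]; simp

/-- Similar idempotents have isomorphic ranges. -/
theorem nonempty_range_equiv_of_conj {p p' : X →L[𝕜] X} (W : (X →L[𝕜] X)ˣ)
    (h : p' = W * p * ↑W⁻¹) : Nonempty (p'.range ≃L[𝕜] p.range) := by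
  have e1 : ∀ x, (↑W⁻¹ : X →L[𝕜] X) (p' x) = p ((↑W⁻¹ : X →L[𝕜] X) x) := fun x => by
    have : (↑W⁻¹ : X →L[𝕜] X) * p' = p * ↑W⁻¹ := by
      rw [h, mul_assoc, Units.inv_mul_cancel_left]
    exact DFunLike.congr_fun this x
  have e2 : ∀ x, (W : X →L[𝕜] X) (p x) = p' ((W : X →L[𝕜] X) x) := fun x => by
    have : (W : X →L[𝕜] X) * p = p' * W := by
      rw [h, Units.inv_mul_cancel_right]
    exact DFunLike.congr_fun this x
  refine ⟨ContinuousLinearEquiv.equivOfInverse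
    (((↑W⁻¹ : X →L[𝕜] X) ∘L p'.range.subtypeL).codRestrict p.range ?_)
    (((W : X →L[𝕜] X) ∘L p.range.subtypeL).codRestrict p'.range ?_) ?_ ?_⟩
  · rintro ⟨_, x, rfl⟩
    exact ⟨_, (e1 x).symm⟩
  · rintro ⟨_, x, rfl⟩
    exact ⟨_, (e2 x).symm⟩
  · intro x
    exact Subtype.ext (DFunLike.congr_fun W.mul_inv (x : X))
  · intro x
    exact Subtype.ext (DFunLike.congr_fun W.inv_mul (x : X))

namespace TrichotomicSplitting

variable {A A' : X →ₗ.[𝕜] X} {T : TrichotomicSplitting A} {T' : TrichotomicSplitting A'}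

theorem HasBounds.hasRates {ρ₀ ρ K : ℝ} (h : T.HasBounds ρ₀ ρ K) :
    T.toBlockForm.HasRates K (Real.exp (-ρ)) (Real.exp ρ₀) where
  stab_le n := by rw [← stableEvol_eq, ← exp_mul_natCast]; exact h.stable_le n
  unst_le n := by rw [← unstableEvol_eq, ← exp_mul_natCast]; exact h.unstable_le n
  cent_le n := by rw [← centralEvol_natCast, ← exp_mul_abs_natCast]; exact h.central_le n
  centInv_le n := by
    rw [← centralEvol_neg_natCast, ← exp_mul_abs_neg_natCast]; exact h.central_le (-n)

theorem isCloseTo_of_isNear {b' : BlockForm A'} {ρ₀' ρ' ε ε' : ℝ} (hε : ε < ε')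
    (h : b'.IsNear T.toBlockForm ε (Real.exp (-ρ')) (Real.exp ρ₀')) :
    b'.toSplitting.IsCloseTo T ρ₀' ρ' ε' where
  proj_lt k := (h.proj_le k).trans_lt hε
  iso k := by
    obtain ⟨W, hW⟩ := h.similar
    exact nonempty_range_equiv_of_conj W (hW k)
  stable_le n := by
    rw [b'.toSplitting_stableEvol, stableEvol_eq, exp_mul_natCast]
    exact (h.stab_le n).trans (by gcongr)
  unstable_le n := by
    rw [b'.toSplitting_unstableEvol, unstableEvol_eq, exp_mul_natCast]
    exact (h.unst_le n).trans (by gcongr)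
  central_le n := by
    obtain ⟨m, rfl | rfl⟩ := n.eq_nat_or_neg
    · rw [b'.toSplitting_centralEvol_natCast, centralEvol_natCast, exp_mul_abs_natCast]
      exact (h.cent_le m).trans (by gcongr)
    · rw [b'.toSplitting_centralEvol_neg_natCast, centralEvol_neg_natCast,
        exp_mul_abs_neg_natCast]
      exact (h.centInv_le m).trans (by gcongr)

theorem IsCloseTo.mono {ρ₀' ρ' ε ε' : ℝ} (hε : ε ≤ ε') (h : T'.IsCloseTo T ρ₀' ρ' ε) :
    T'.IsCloseTo T ρ₀' ρ' ε' where
  proj_lt k := (h.proj_lt k).trans_le hε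
  iso := h.iso
  stable_le n := (h.stable_le n).trans (by gcongr)
  unstable_le n := (h.unstable_le n).trans (by gcongr)
  central_le n := (h.central_le n).trans (by gcongr)

theorem IsCloseTo.hasBounds {ρ₀ ρ₀' ρ' ρ κ κ' ε : ℝ} (hρ₀' : ρ₀ ≤ ρ₀') (hρ' : ρ₀' < ρ')
    (hρ : ρ' ≤ ρ) (hκ' : κ + ε ≤ κ') (hκ'' : κ ≤ κ') (h : T'.IsCloseTo T ρ₀' ρ' ε)
    (hT : T.HasBounds ρ₀ ρ κ) : T'.HasBounds ρ₀' ρ' κ' := by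
  have hκ0 : 0 ≤ κ := zero_le_one.trans hT.one_le
  have key : ∀ (Y Y' : X →L[𝕜] X) (q q' : ℝ), q ≤ q' → 0 ≤ q' → ‖Y‖ ≤ κ * q →
      ‖Y' - Y‖ ≤ ε * q' → ‖Y'‖ ≤ κ' * q' := fun Y Y' q q' hq hq' h1 h2 => by
    have h3 := norm_add_le (Y' - Y) Y
    rw [sub_add_cancel] at h3
    nlinarith [mul_le_mul_of_nonneg_left hq hκ0, mul_le_mul_of_nonneg_right hκ' hq']
  exact
    { exponents := ⟨hT.exponents.1.trans_le hρ₀', hρ'⟩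
      one_le := hT.one_le.trans hκ''
      central_le := fun n => key _ _ _ _ (by gcongr) (Real.exp_nonneg _) (hT.central_le n)
        (h.central_le n)
      stable_le := fun n => key _ _ _ _ (by gcongr) (Real.exp_nonneg _) (hT.stable_le n)
        (h.stable_le n)
      unstable_le := fun n => key _ _ _ _ (by gcongr) (Real.exp_nonneg _) (hT.unstable_le n)
        (h.unstable_le n) }

theorem norm_extend_le (k : TriLabel) (L : T.space k →L[𝕜] T.space k) :
    ‖T.extend k L‖ ≤ ‖L‖ * ‖T.proj k‖ := by
  refine ContinuousLinearMap.opNorm_le_bound _ (by positivity) fun x => ?_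
  rw [extend_apply, mul_assoc]
  exact (L.le_opNorm _).trans (by gcongr; exact (T.proj k).le_opNorm x)

theorem HasSubspaceBounds.hasBounds {ρ₀ ρ κ M : ℝ} (h : T.HasSubspaceBounds ρ₀ ρ κ)
    (hM : ∀ k, ‖T.proj k‖ ≤ M) (hM1 : 1 ≤ M) : T.HasBounds ρ₀ ρ (κ * M) := by
  have hκ0 : 0 ≤ κ := zero_le_one.trans h.one_le
  have key : ∀ (k) (L : T.space k →L[𝕜] T.space k) (q : ℝ), 0 ≤ q → ‖L‖ ≤ κ * q →
      ‖T.extend k L‖ ≤ κ * M * q := fun k L q hq hL => by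
    calc ‖T.extend k L‖ ≤ κ * q * M := (norm_extend_le k L).trans (by gcongr; exact hM k)
      _ = _ := by ring
  exact
    { exponents := h.exponents
      one_le := one_le_mul_of_one_le_of_one_le h.one_le hM1
      central_le := fun n => key _ _ _ (Real.exp_nonneg _) (h.central_le n)
      stable_le := fun n => key _ _ _ (Real.exp_nonneg _) (h.stable_le n)
      unstable_le := fun n => key _ _ _ (Real.exp_nonneg _) (h.unstable_le n) }

/-- On the range of the new projector the old one has norm at most $1+\varepsilon$, since it is
$\varepsilon$-close to a projector acting there as the identity. Hence the subspace constant changes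
little, with no factor $\|\Pi_k\|$. -/
theorem norm_le_of_norm_extend_sub_le {k : TriLabel} {L : T.space k →L[𝕜] T.space k}
    {L' : T'.space k →L[𝕜] T'.space k} {κ ε q q' : ℝ} (hκ : 0 ≤ κ) (hε : 0 ≤ ε) (hq0 : 0 ≤ q)
    (hq : q ≤ q') (hL : ‖L‖ ≤ κ * q) (hd : ‖T'.extend k L' - T.extend k L‖ ≤ ε * q')
    (hp : ‖T'.proj k - T.proj k‖ ≤ ε) : ‖L'‖ ≤ (κ * (1 + ε) + ε) * q' := by
  have hq'0 := hq0.trans hq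
  refine ContinuousLinearMap.opNorm_le_bound _ (by positivity) fun x => ?_
  have e1 : ‖L' x‖ = ‖T'.extend k L' x‖ := by rw [T'.extend_apply_of_mem L' x.2]; rfl
  have e2 : ‖T.proj k x‖ ≤ (1 + ε) * ‖x‖ := by
    have h1 : T.proj k x = (x : X) - (T'.proj k - T.proj k) x := by
      change _ = (x : X) - (T'.proj k x - T.proj k x)
      rw [T'.proj_apply_of_mem x.2, sub_sub_cancel]
    have h2 := (T'.proj k - T.proj k).le_of_opNorm_le hp (x : X)
    have h3 := norm_sub_le (x : X) ((T'.proj k - T.proj k) x)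
    rw [← h1] at h3
    have h4 : ‖(x : X)‖ = ‖x‖ := rfl
    rw [h4] at h2 h3
    linarith
  have e3 : ‖T.extend k L x‖ ≤ κ * q * ((1 + ε) * ‖x‖) := by
    rw [extend_apply]
    exact (L.le_of_opNorm_le hL _).trans (by gcongr; exact e2)
  have e4 : ‖T'.extend k L' x - T.extend k L x‖ ≤ ε * q' * ‖x‖ :=
    (T'.extend k L' - T.extend k L).le_of_opNorm_le hd (x : X)
  have e5 := norm_add_le (T'.extend k L' x - T.extend k L x) (T.extend k L x)
  rw [sub_add_cancel, ← e1] at e5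
  calc ‖L' x‖ ≤ ε * q' * ‖x‖ + κ * q * ((1 + ε) * ‖x‖) := e5.trans (add_le_add e4 e3)
    _ ≤ ε * q' * ‖x‖ + κ * q' * ((1 + ε) * ‖x‖) := by gcongr
    _ = _ := by ring

theorem IsCloseTo.hasSubspaceBounds {ρ₀ ρ₀' ρ' ρ κ κ' ε : ℝ} (hρ₀' : ρ₀ ≤ ρ₀') (hρ' : ρ₀' < ρ')
    (hρ : ρ' ≤ ρ) (hκ' : κ * (1 + ε) + ε ≤ κ') (hκ'' : κ ≤ κ') (hε : 0 ≤ ε)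
    (h : T'.IsCloseTo T ρ₀' ρ' ε) (hT : T.HasSubspaceBounds ρ₀ ρ κ) :
    T'.HasSubspaceBounds ρ₀' ρ' κ' := by
  have hκ0 : 0 ≤ κ := zero_le_one.trans hT.one_le
  have key : ∀ (k) (L : T.space k →L[𝕜] T.space k) (L' : T'.space k →L[𝕜] T'.space k) (q q' : ℝ),
      0 ≤ q → q ≤ q' → ‖L‖ ≤ κ * q → ‖T'.extend k L' - T.extend k L‖ ≤ ε * q' →
      ‖L'‖ ≤ κ' * q' := fun k L L' q q' hq hqq' hL hd =>
    (norm_le_of_norm_extend_sub_le hκ0 hε hq hqq' hL hd (h.proj_lt k).le).trans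
      (mul_le_mul_of_nonneg_right hκ' (hq.trans hqq'))
  exact
    { exponents := ⟨hT.exponents.1.trans_le hρ₀', hρ'⟩
      one_le := hT.one_le.trans hκ''
      central_le := fun n => key _ _ _ _ _ (Real.exp_nonneg _) (by gcongr) (hT.central_le n)
        (h.central_le n)
      stable_le := fun n => key _ _ _ _ _ (Real.exp_nonneg _) (by gcongr) (hT.stable_le n)
        (h.stable_le n)
      unstable_le := fun n => key _ _ _ _ _ (Real.exp_nonneg _) (by gcongr) (hT.unstable_le n)
        (h.unstable_le n) }

end TrichotomicSplitting

end Assembly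

/-! ### Choice of constants and the theorem. -/

/-- Roughness of trichotomies with linear dependence on the size of the perturbation. -/
theorem exists_trichotomy_isCloseTo_linear (ρ₀ ρ₀' ρ' ρ K : ℝ) (hρ₀ : 0 < ρ₀) (hρ₀' : ρ₀ < ρ₀')
    (hρ' : ρ₀' < ρ') (hρ : ρ' < ρ) (hK : 1 ≤ K) :
    ∃ C d : ℝ, 0 < C ∧ 0 < d ∧
      ∀ (𝕜 : Type u) [RCLike 𝕜] (X : Type v) [NormedAddCommGroup X] [NormedSpace 𝕜 X]
        [CompleteSpace X] (A : X →ₗ.[𝕜] X) (T : TrichotomicSplitting A),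
        T.HasBounds ρ₀ ρ K → ∀ δ : ℝ, 0 < δ → δ ≤ d → ∀ B : X →L[𝕜] X, ‖B‖ ≤ δ →
          ∃ T' : TrichotomicSplitting ((B : X →ₗ[𝕜] X) +ᵥ A), T'.IsCloseTo T ρ₀' ρ' (C * δ) := by
  set r := Real.exp (-ρ) with hr
  set r' := Real.exp (-ρ') with hr'
  set a := Real.exp ρ₀ with ha
  set a' := Real.exp ρ₀' with ha'
  have hr0 : 0 ≤ r := Real.exp_nonneg _
  have ha1 : 1 ≤ a := Real.one_le_exp hρ₀.le
  have hra : r ≤ a := Real.exp_le_exp.2 (by linarith)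
  have hlt : a * r < 1 := by
    rw [ha, hr, ← Real.exp_add, Real.exp_lt_one_iff]
    linarith
  have hrr' : r < r' := Real.exp_lt_exp.2 (by linarith)
  have haa' : a < a' := Real.exp_lt_exp.2 (by linarith)
  set g := min (r' - r) (a' - a) with hgdef
  have hg : 0 < g := lt_min (by linarith) (by linarith)
  set s := BlockForm.simConst K r a with hs
  have hs0 : 0 ≤ s := BlockForm.simConst_nonneg ha1 hlt
  set c := 12 * K ^ 4 * a ^ 2 with hc
  have hc0 : 0 ≤ c := by positivity
  have hcg : 0 ≤ K * c / g := by positivity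
  -- The condition $\delta N \le 1$ enforces all three smallness conditions of `exists_isNear` at
  -- once.
  set N := 1 + 3 * s + c + K * c / g with hN
  have hN0 : 0 < N := by positivity
  -- The extra $1$ makes the closeness of the projectors strict.
  refine ⟨6 * s * K + K * (K * c / g) + 1, 1 / N, by positivity, by positivity, ?_⟩
  intro 𝕜 _ X _ _ _ A T hT δ hδ hδd B hB
  rw [le_div_iff₀ hN0] at hδd
  have f1 : 0 ≤ s * δ := by positivity
  have f2 : 0 ≤ c * δ := by positivity
  have f3 : 0 ≤ K * c / g * δ := by positivity
  have f4 : δ * N = δ + 3 * (s * δ) + c * δ + K * c / g * δ := by rw [hN]; ring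
  have h3 : K * (c * δ) ≤ g := by
    have : K * c / g * δ ≤ 1 := by linarith
    have h4 : K * (c * δ) = K * c / g * δ * g := by field_simp
    rw [h4]
    nlinarith
  obtain ⟨b', hb'⟩ := T.toBlockForm.exists_isNear hT.hasRates hK hr0 ha1 hra hlt hg
    (min_le_left _ _) (min_le_right _ _) hB (by linarith) (by linarith) h3
  refine ⟨b'.toSplitting, TrichotomicSplitting.isCloseTo_of_isNear ?_ hb'⟩
  have : 6 * (s * δ) * K + K * (K * (c * δ) / g) = (6 * s * K + K * (K * c / g)) * δ := by
    ring
  rw [this]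
  linarith

theorem exists_perturbation_threshold {κ κ' C d : ℝ} (hκ : 1 ≤ κ) (hκ' : κ < κ') (hC : 0 < C)
    (hd : 0 < d) : ∃ δ₀ : ℝ, 0 < δ₀ ∧ δ₀ < √2 - 1 ∧ κ * (1 + δ₀) + δ₀ ≤ κ' ∧
      ∀ δ : ℝ, 0 < δ → δ < δ₀ ^ 2 / (κ + δ₀) →
        δ ≤ d ∧ C * δ ≤ κ * δ / (δ₀ - δ) ∧ κ * δ / (δ₀ - δ) ≤ δ₀ := by
  have hκ0 : 0 < κ := by linarith
  have hκκ' : 0 < (κ' - κ) / (κ + 1) := div_pos (by linarith) (by linarith)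
  -- $1/4 < \sqrt2 - 1$; $\kappa/C$ gives $C(\delta_0-\delta) \le \kappa$; the last bound is
  -- $\kappa(1+\delta_0)+\delta_0 \le \kappa'$, which serves both kinds of norms. The bound by
  -- $\delta_0$ is just $\delta(\kappa+\delta_0) \le \delta_0^2$ rearranged.
  obtain ⟨δ₀, h0, h1, h2, h3, h4⟩ : ∃ δ₀ : ℝ, 0 < δ₀ ∧ δ₀ ≤ 1 / 4 ∧ δ₀ ≤ d ∧ δ₀ ≤ κ / C ∧
      δ₀ ≤ (κ' - κ) / (κ + 1) :=
    ⟨min (min (1 / 4) d) (min (κ / C) ((κ' - κ) / (κ + 1))), by positivity,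
      (min_le_left _ _).trans (min_le_left _ _), (min_le_left _ _).trans (min_le_right _ _),
      (min_le_right _ _).trans (min_le_left _ _), (min_le_right _ _).trans (min_le_right _ _)⟩
  rw [le_div_iff₀ hC] at h3
  rw [le_div_iff₀ (by linarith)] at h4
  refine ⟨δ₀, h0, ?_, by linarith, fun δ hδ hδ' => ?_⟩
  · have : (5 / 4 : ℝ) < √2 := Real.lt_sqrt_of_sq_lt (by norm_num)
    linarith
  · rw [lt_div_iff₀ (by linarith)] at hδ'
    have hlt : δ < δ₀ := by nlinarith
    have hpos : 0 < δ₀ - δ := by linarith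
    refine ⟨by linarith, ?_, ?_⟩
    · rw [le_div_iff₀ hpos]
      nlinarith [mul_pos hC hδ]
    · rw [div_le_iff₀ hpos]
      nlinarith

theorem theorem1p4 (ρ₀ ρ₀' ρ' ρ κ κ' : ℝ)
    (hρ₀ : 0 < ρ₀) (hρ₀' : ρ₀ < ρ₀') (hρ' : ρ₀' < ρ') (hρ : ρ' < ρ) (hκ : 1 ≤ κ) (hκ' : κ < κ') :
    (∃ δ₀ : ℝ, 0 < δ₀ ∧ δ₀ < √2 - 1 ∧
      ∀ (𝕜 : Type u) [RCLike 𝕜] (X : Type v) [NormedAddCommGroup X] [NormedSpace 𝕜 X]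
        [CompleteSpace X] (A : X →ₗ.[𝕜] X) (T : TrichotomicSplitting A),
        T.HasBounds ρ₀ ρ κ →
        ∀ δ : ℝ, 0 < δ → δ < δ₀ ^ 2 / (κ + δ₀) →
        ∀ B : X →L[𝕜] X, ‖B‖ ≤ δ →
          ∃ T' : TrichotomicSplitting ((B : X →ₗ[𝕜] X) +ᵥ A),
            T'.HasBounds ρ₀' ρ' κ' ∧
            T'.IsCloseTo T ρ₀' ρ' (κ * δ / (δ₀ - δ)) ∧
            κ * δ / (δ₀ - δ) ≤ δ₀) ∧
    (∀ M : ℝ, ∃ δ₀ : ℝ, 0 < δ₀ ∧ δ₀ < √2 - 1 ∧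
      ∀ (𝕜 : Type u) [RCLike 𝕜] (X : Type v) [NormedAddCommGroup X] [NormedSpace 𝕜 X]
        [CompleteSpace X] (A : X →ₗ.[𝕜] X) (T : TrichotomicSplitting A),
        T.HasSubspaceBounds ρ₀ ρ κ → (∀ k, ‖T.proj k‖ ≤ M) →
        ∀ δ : ℝ, 0 < δ → δ < δ₀ ^ 2 / (κ + δ₀) →
        ∀ B : X →L[𝕜] X, ‖B‖ ≤ δ →
          ∃ T' : TrichotomicSplitting ((B : X →ₗ[𝕜] X) +ᵥ A),
            T'.HasSubspaceBounds ρ₀' ρ' κ' ∧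
            T'.IsCloseTo T ρ₀' ρ' (κ * δ / (δ₀ - δ)) ∧
            κ * δ / (δ₀ - δ) ≤ δ₀) := by
  constructor
  · obtain ⟨C, d, hC, hd, hmain⟩ :=
      exists_trichotomy_isCloseTo_linear.{u, v} ρ₀ ρ₀' ρ' ρ κ hρ₀ hρ₀' hρ' hρ hκ
    obtain ⟨δ₀, h0, h1, h2, hδ₀⟩ := exists_perturbation_threshold hκ hκ' hC hd
    refine ⟨δ₀, h0, h1, fun 𝕜 _ X _ _ _ A T hT δ hδ hδ' B hB => ?_⟩
    obtain ⟨g1, g2, g3⟩ := hδ₀ δ hδ hδ'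
    obtain ⟨T', hT'⟩ := hmain 𝕜 X A T hT δ hδ g1 B hB
    have hT'' := hT'.mono g2
    exact ⟨T', hT''.hasBounds hρ₀'.le hρ' hρ.le (by nlinarith) hκ'.le hT, hT'', g3⟩
  · intro M
    have hM1 : 1 ≤ max M 1 := le_max_right _ _
    obtain ⟨C, d, hC, hd, hmain⟩ :=
      exists_trichotomy_isCloseTo_linear.{u, v} ρ₀ ρ₀' ρ' ρ (κ * max M 1) hρ₀ hρ₀' hρ' hρ
        (one_le_mul_of_one_le_of_one_le hκ hM1)
    -- The threshold is taken with $\kappa$ itself: $M$ enters only through $C$ and $d$.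
    obtain ⟨δ₀, h0, h1, h2, hδ₀⟩ := exists_perturbation_threshold hκ hκ' hC hd
    refine ⟨δ₀, h0, h1, fun 𝕜 _ X _ _ _ A T hT hM δ hδ hδ' B hB => ?_⟩
    obtain ⟨g1, g2, g3⟩ := hδ₀ δ hδ hδ'
    obtain ⟨T', hT'⟩ := hmain 𝕜 X A T
      (hT.hasBounds (fun k => (hM k).trans (le_max_left _ _)) hM1) δ hδ g1 B hB
    have hT'' := hT'.mono g2
    have hε : 0 ≤ κ * δ / (δ₀ - δ) := (mul_pos hC hδ).le.trans g2
    refine ⟨T', hT''.hasSubspaceBounds hρ₀'.le hρ' hρ.le (by nlinarith) hκ'.le hε hT, hT'', g3⟩
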